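/- Let $n\ge 2$ be an integer. For every prime $p$ let $A_p=\mathbb{F}_p[[x_1,\dots,x_n]]$ and $f=x_1^2+\cdots+x_n^2\in A_p$, and let $\phi_{f,p}\colon[0,1]\to\mathbb{R}$ be the continuous function with $$\phi_{f,p}\Big(\frac{a}{p^e}\Big)=\frac{1}{p^{ne}}\dim_{\mathbb{F}_p}\big(A_p/(x_1^{p^e},\dots,x_n^{p^e},f^a)\big)\qquad\text{for all integers } e\ge 0,\ 0\le a\le p^e .$$ (Such a function exists and is unique.) As the prime $p$ tends to infinity, the functions $\phi_{f,p}$ converge uniformly on $[0,1]$ to a function $\phi_f$. Let $E_n(t)$ be the $n$-th Euler polynomial, defined by $\frac{2e^{xt}}{e^x+1}=\sum_{k\ge0}E_k(t)\frac{x^k}{k!}$. Then: 1. If $n$ is even, then for all $t\in[0,1]$ $$\phi_f(t)=t+\frac{(-1)^{n/2}\,2^{n-1}}{n!}E_n(t).$$ 2. If $n$ is odd, then for all $t\in[0,\tfrac12]$ $$\phi_f(t)=t+\frac{(-1)^{(n-1)/2}\,2^{n-1}}{n!}E_n\!\left(t+\tfrac12\right).$$ 3. If $n$ is odd, then for all $t\in[\tfrac12,1]$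 $$\phi_f(t)=t-\frac{(-1)^{(n-1)/2}\,2^{n-1}}{n!}E_n\!\left(t-\tfrac12\right).$$ -/

import Mathlib

open Filter Topology

noncomputable section

/-- The Fermat quadric `x₁² + ⋯ + xₙ²` in `𝔽_p⟦x₁, …, xₙ⟧`. -/
def fermatQuadric (n p : ℕ) : MvPowerSeries (Fin n) (ZMod p) :=
  ∑ i, (MvPowerSeries.X i) ^ 2

/-- The ideal `(x₁^(p^e), …, xₙ^(p^e), f^a)` of `𝔽_p⟦x₁, …, xₙ⟧`. -/
def phiIdeal {n p : ℕ} (f : MvPowerSeries (Fin n) (ZMod p)) (e a : ℕ) :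
    Ideal (MvPowerSeries (Fin n) (ZMod p)) :=
  Ideal.span (Set.range (fun i : Fin n => (MvPowerSeries.X i) ^ (p ^ e)) ∪ {f ^ a})

/-- `p^(-ne) * dim_{𝔽_p} (𝔽_p⟦x₁, …, xₙ⟧ / (x₁^(p^e), …, xₙ^(p^e), f^a))`,
the value of `φ_{f,p}` at `a / p^e`. -/
def phiValue {n p : ℕ} (f : MvPowerSeries (Fin n) (ZMod p)) (e a : ℕ) : ℝ :=
  (Module.finrank (ZMod p) (MvPowerSeries (Fin n) (ZMod p) ⧸ phiIdeal f e a) : ℝ)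
    / (p : ℝ) ^ (n * e)

/-- `φ` is the function `φ_{f,p}` on `[0,1]`, i.e. the continuous extension to `[0,1]` of the
function `a / p^e ↦ p^(-ne) * dim (𝔽_p⟦x⟧ / (x₁^(p^e), …, xₙ^(p^e), f^a))`. For `p` prime the
points `a / p^e` are dense in `[0,1]`, so `φ` is uniquely determined on `[0,1]`.
Its values outside `[0,1]` are irrelevant. -/
structure IsPhi {n p : ℕ} (f : MvPowerSeries (Fin n) (ZMod p)) (φ : ℝ → ℝ) : Prop where
  continuousOn : ContinuousOn φ (Set.Icc 0 1)
  apply_div : ∀ e a : ℕ, a ≤ p ^ e → φ ((a : ℝ) / (p : ℝ) ^ e) = phiValue f e a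

/-- `φ` is (on `[0,1]`) the limit function `φ_f` of a family `f = (f_p)_p` of power series: all the
functions `φ_{f,p}`, `p` prime, exist on `[0,1]`, and they converge to `φ` uniformly on `[0,1]`
as the prime `p` tends to infinity. -/
def IsLimitPhi {n : ℕ} (f : ∀ p : ℕ, MvPowerSeries (Fin n) (ZMod p)) (φ : ℝ → ℝ) : Prop :=
  ∃ Φ : ℕ → ℝ → ℝ, (∀ p : ℕ, p.Prime → IsPhi (f p) (Φ p)) ∧
    TendstoUniformlyOn Φ φ (atTop ⊓ 𝓟 {p : ℕ | p.Prime}) (Set.Icc 0 1)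

/-- The power series `2 e^(xt) / (e^x + 1)` in the variable `x`, with coefficients in `ℚ[t]`.
The constant term of `e^x + 1 ∈ ℚ⟦x⟧` is `2`, so the inverse is a true inverse. -/
def eulerGenFun : PowerSeries (Polynomial ℚ) :=
  2 * PowerSeries.rescale Polynomial.X (PowerSeries.exp (Polynomial ℚ)) *
    PowerSeries.map Polynomial.C (PowerSeries.exp ℚ + 1)⁻¹

/-- The Euler polynomials `E_k(t)`, defined by `2 e^(xt) / (e^x + 1) = ∑ E_k(t) x^k / k!`. -/
def eulerPolynomial (k : ℕ) : Polynomial ℚ :=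
  (k.factorial : Polynomial ℚ) * PowerSeries.coeff k eulerGenFun

end

/-! ### Dimensions of quotients under surjections -/

section Quotients

variable {k A B : Type*} [CommRing k] [CommRing A] [CommRing B] [Algebra k A] [Algebra k B]

/-! Fix an odd prime p = 2h + 1. Let R be the truncated polynomial ring in n variables, with box
size p, and T the sum of squares in it. One more variable X turns the quotient into R[X] / (X^p, (X²
+ T)^a). Splitting into even and odd parts in X expresses its dimension by D(m, a) = dim R[X] /
(X^m, (X + T)^a) with m = h + 1 and m = h.

The central fact is a discrete wave equation, D(m+2, a+1) + D(m, a+1) = D(m+1, a+2) + D(m+1, a)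
(`finrank_quotient_span_pow_pair_wave`). Both sides compute dimensions of quotients of R[X][ε],
exchanged by the automorphism s ↦ s + ε s', ε ↦ -ε. The row m = 1 is the answer in n variables, and
the edges a = 0 and a = p are known. The d'Alembert solution then says that one more variable
replaces the sequence by its sum over a centred window of length p (`boxDim_eq_boxSeq`).

After one step the normalized sequence is exactly the identity plus a triangle wave of period 2.
Later steps average over windows of length close to 1, so as p grows the limit is t plus the
(n-1)-fold unit-window average of the triangle wave. Frobenius compatibility and a Lipschitz bound 2
independent of p make the values at a/p sufficient for uniform convergence
(`tendstoUniformlyOn_of_isPhi`).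

The averaged waves W_m satisfy W_m(t + 1) = -W_m(t) and W_{m+1}'(t) = -2 W_m(t - 1/2). Up to shift
and scaling these are the relations E_n(1) = -E_n(0) and E_{n+1}' = (n + 1) E_n, which determine the
Euler polynomials inductively (`limitWave_add_half_eq`). -/

theorem nonempty_quotient_equiv_map (ψ : A →ₐ[k] B) (hψ : Function.Surjective ψ) (J : Ideal A)
    (hker : RingHom.ker ψ ≤ J) : Nonempty ((A ⧸ J) ≃ₗ[k] B ⧸ J.map ψ) := by
  have hc : (J.map ψ).comap ψ = J := by
    rw [Ideal.comap_map_of_surjective' ψ hψ, sup_eq_left.mpr hker]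
  let Ψ : (A ⧸ J) →ₐ[k] B ⧸ J.map ψ := Ideal.quotientMapₐ (J.map ψ) ψ hc.ge
  refine ⟨LinearEquiv.ofBijective Ψ.toLinearMap ⟨?_, ?_⟩⟩
  · exact Ideal.quotientMap_injective' (f := (ψ : A →+* B)) (H := hc.ge) hc.le
  · exact Ideal.quotientMap_surjective (f := (ψ : A →+* B)) (H := hc.ge) hψ

theorem finrank_quotient_map_of_surjective (ψ : A →ₐ[k] B) (hψ : Function.Surjective ψ)
    (J : Ideal A) (hker : RingHom.ker ψ ≤ J) :
    Module.finrank k (A ⧸ J) = Module.finrank k (B ⧸ J.map ψ) :=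
  (nonempty_quotient_equiv_map ψ hψ J hker).some.finrank_eq

/-- Passing to the quotient in two steps. -/
theorem finrank_quotient_quotient {I J : Ideal A} (hIJ : I ≤ J) :
    Module.finrank k (A ⧸ J) =
      Module.finrank k ((A ⧸ I) ⧸ J.map (Ideal.Quotient.mkₐ k I)) :=
  finrank_quotient_map_of_surjective _ (Ideal.Quotient.mkₐ_surjective k I) J
    (fun _ hx => hIJ (Ideal.Quotient.eq_zero_iff_mem.mp hx))

end Quotients

/-! ### From power series to polynomials -/

section PowerSeries

variable {σ k : Type*} [CommRing k]

/-- A power series has infinitely many terms, so they cannot be treated one by one. Instead the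
variables in `s` are removed one at a time: the terms with exponent at least q in one variable
together form a multiple of its q-th power. -/
theorem MvPowerSeries.mem_span_X_pow_of_coeff_eq_zero (q : ℕ) (s : Finset σ)
    (g : MvPowerSeries σ k)
    (hg : ∀ m : σ →₀ ℕ, (∀ i ∈ s, m i < q) → MvPowerSeries.coeff m g = 0) :
    g ∈ Ideal.span (Set.range fun i : σ => (MvPowerSeries.X i : MvPowerSeries σ k) ^ q) := by
  classical
  induction s using Finset.induction_on generalizing g with
  | empty =>
    have : g = 0 := by
      ext m
      simpa using hg m (by simp)
    rw [this]
    exact Ideal.zero_mem _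
  | insert i s _ ih =>
    let g₁ : MvPowerSeries σ k := fun m => if m i < q then MvPowerSeries.coeff m g else 0
    have h₁ : ∀ m, MvPowerSeries.coeff m g₁ = if m i < q then MvPowerSeries.coeff m g else 0 :=
      fun m => rfl
    have hg₁ : g₁ ∈ Ideal.span (Set.range fun i : σ => (MvPowerSeries.X i : MvPowerSeries σ k) ^ q) := by
      refine ih g₁ fun m hm => ?_
      rw [h₁]
      split_ifs with h
      · exact hg m (by simpa using ⟨h, hm⟩)
      · rfl
    have hd : (MvPowerSeries.X i : MvPowerSeries σ k) ^ q ∣ g - g₁ := by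
      rw [MvPowerSeries.X_pow_dvd_iff]
      intro m hm
      rw [map_sub, h₁, if_pos hm, sub_self]
    have := Ideal.add_mem _ hg₁
      (Ideal.mem_of_dvd _ hd (Ideal.subset_span ⟨i, rfl⟩))
    simpa using this

theorem MvPowerSeries.coeff_eq_zero_of_mem_span_X_pow {q : ℕ} {g : MvPowerSeries σ k}
    (hg : g ∈ Ideal.span (Set.range fun i : σ => (MvPowerSeries.X i : MvPowerSeries σ k) ^ q))
    (m : σ →₀ ℕ) (hm : ∀ i, m i < q) : MvPowerSeries.coeff m g = 0 := by
  classical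
  induction hg using Submodule.span_induction generalizing m with
  | mem x hx =>
    obtain ⟨i, rfl⟩ := hx
    exact MvPowerSeries.X_pow_dvd_iff.mp dvd_rfl m (hm i)
  | zero => simp
  | add x y _ _ hx hy => simp [hx m hm, hy m hm]
  | smul a x _ hx =>
    rw [smul_eq_mul, MvPowerSeries.coeff_mul]
    refine Finset.sum_eq_zero fun uv huv => ?_
    rw [Finset.HasAntidiagonal.mem_antidiagonal] at huv
    rw [hx uv.2 fun i => lt_of_le_of_lt (by rw [← huv]; simp) (hm i), mul_zero]

theorem MvPolynomial.mem_span_X_pow_of_coeff_eq_zero (q : ℕ) (g : MvPolynomial σ k)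
    (hg : ∀ m : σ →₀ ℕ, (∀ i, m i < q) → MvPolynomial.coeff m g = 0) :
    g ∈ Ideal.span (Set.range fun i : σ => (MvPolynomial.X i : MvPolynomial σ k) ^ q) := by
  classical
  rw [g.as_sum]
  refine Ideal.sum_mem _ fun m hm => ?_
  have : ∃ i, q ≤ m i := by
    by_contra! h
    exact (MvPolynomial.mem_support_iff.mp hm) (hg m h)
  obtain ⟨i, hi⟩ := this
  refine Ideal.mem_of_dvd _ ?_ (Ideal.subset_span ⟨i, rfl⟩)
  change MvPolynomial.X i ^ q ∣ _
  rw [MvPolynomial.X_pow_eq_monomial]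
  refine MvPolynomial.monomial_dvd_monomial.mpr ⟨Or.inr ?_, one_dvd _⟩
  simpa using hi

/-- Modulo the q-th powers of the variables, every power series agrees with a truncation, and a
polynomial that vanishes there already lies in the corresponding polynomial ideal. -/
theorem finrank_mvPowerSeries_quotient_span_X_pow_union [Fintype σ] (q : ℕ)
    (S : Set (MvPolynomial σ k)) :
    Module.finrank k (MvPowerSeries σ k ⧸ Ideal.span
      (Set.range (fun i : σ => (MvPowerSeries.X i : MvPowerSeries σ k) ^ q) ∪
        (fun g : MvPolynomial σ k => (g : MvPowerSeries σ k)) '' S)) =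
    Module.finrank k (MvPolynomial σ k ⧸ Ideal.span
      (Set.range (fun i : σ => (MvPolynomial.X i : MvPolynomial σ k) ^ q) ∪ S)) := by
  classical
  set I := Ideal.span (Set.range fun i : σ => (MvPowerSeries.X i : MvPowerSeries σ k) ^ q) with hI
  let ψ : MvPolynomial σ k →ₐ[k] MvPowerSeries σ k ⧸ I :=
    (Ideal.Quotient.mkₐ k I).comp (MvPolynomial.coeToMvPowerSeries.algHom k)
  have hψ : ∀ g : MvPolynomial σ k, ψ g = Ideal.Quotient.mk I (g : MvPowerSeries σ k) := by
    intro g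
    simp [ψ]
  clear_value ψ
  have hsurj : Function.Surjective ψ := by
    intro y
    obtain ⟨g, rfl⟩ := Ideal.Quotient.mk_surjective y
    let b : σ →₀ ℕ := Finsupp.equivFunOnFinite.symm fun _ => q - 1
    refine ⟨MvPowerSeries.trunc' k b g, ?_⟩
    rw [hψ, eq_comm, Ideal.Quotient.eq]
    refine MvPowerSeries.mem_span_X_pow_of_coeff_eq_zero q Finset.univ _ fun m hm => ?_
    have hmb : m ≤ b := fun i => Nat.le_sub_one_of_lt (hm i (Finset.mem_univ i))
    rw [map_sub, MvPolynomial.coeff_coe, MvPowerSeries.coeff_trunc', if_pos hmb, sub_self]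
  have hker : RingHom.ker ψ ≤ Ideal.span
      (Set.range (fun i : σ => (MvPolynomial.X i : MvPolynomial σ k) ^ q) ∪ S) := by
    intro g hg
    refine Ideal.span_mono Set.subset_union_left ?_
    refine MvPolynomial.mem_span_X_pow_of_coeff_eq_zero q g fun m hm => ?_
    rw [RingHom.mem_ker, hψ, Ideal.Quotient.eq_zero_iff_mem] at hg
    rw [← MvPolynomial.coeff_coe]
    exact MvPowerSeries.coeff_eq_zero_of_mem_span_X_pow hg m hm
  rw [finrank_quotient_map_of_surjective ψ hsurj _ hker,
    finrank_quotient_quotient (Ideal.span_mono (Set.subset_union_left) : I ≤ _)]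
  have heq : Ideal.map (Ideal.Quotient.mkₐ k I) (Ideal.span
      (Set.range (fun i : σ => (MvPowerSeries.X i : MvPowerSeries σ k) ^ q) ∪
        (fun g : MvPolynomial σ k => (g : MvPowerSeries σ k)) '' S)) =
      Ideal.map ψ (Ideal.span
      (Set.range (fun i : σ => (MvPolynomial.X i : MvPolynomial σ k) ^ q) ∪ S)) := by
    rw [Ideal.map_span, Ideal.map_span, Set.image_union, Set.image_union, ← Set.range_comp,
      ← Set.range_comp, Set.image_image]
    congr 2
    · congr 1
      ext i
      simp [hψ]
    · refine Set.image_congr fun g _ => ?_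
      rw [hψ]
      rfl
  rw [heq]

end PowerSeries

noncomputable section

/-! ### Truncated polynomial rings, one variable at a time -/

section Recursion

open Polynomial

variable (k : Type*) [Field k]

/-- The ideal `(x₁^q, …, xₙ^q)`. -/
def boxIdeal (n q : ℕ) : Ideal (MvPolynomial (Fin n) k) :=
  Ideal.span (Set.range fun i => (MvPolynomial.X i) ^ q)

/-- The truncated polynomial ring `k[x₁, …, xₙ] / (x₁^q, …, xₙ^q)`. -/
def BoxRing (n q : ℕ) : Type _ := MvPolynomial (Fin n) k ⧸ boxIdeal k n q

instance (n q : ℕ) : CommRing (BoxRing k n q) :=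
  inferInstanceAs (CommRing (MvPolynomial (Fin n) k ⧸ boxIdeal k n q))

instance (n q : ℕ) : Algebra k (BoxRing k n q) :=
  inferInstanceAs (Algebra k (MvPolynomial (Fin n) k ⧸ boxIdeal k n q))

/-- The quotient map onto the truncated polynomial ring. -/
def boxMk (n q : ℕ) : MvPolynomial (Fin n) k →ₐ[k] BoxRing k n q :=
  Ideal.Quotient.mkₐ k (boxIdeal k n q)

theorem boxMk_surjective (n q : ℕ) : Function.Surjective (boxMk k n q) :=
  Ideal.Quotient.mk_surjective

theorem boxMk_eq_zero_iff {n q : ℕ} {g : MvPolynomial (Fin n) k} :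
    boxMk k n q g = 0 ↔ g ∈ boxIdeal k n q :=
  Ideal.Quotient.eq_zero_iff_mem

theorem X_pow_mem_boxIdeal {n q : ℕ} (i : Fin n) :
    (MvPolynomial.X i : MvPolynomial (Fin n) k) ^ q ∈ boxIdeal k n q :=
  Ideal.subset_span ⟨i, rfl⟩

theorem ker_boxMk_le (n q : ℕ) : RingHom.ker (boxMk k n q) ≤ boxIdeal k n q :=
  fun _ h => (boxMk_eq_zero_iff k).mp (RingHom.mem_ker.mp h)

theorem map_boxMk_boxIdeal (n q : ℕ) : (boxIdeal k n q).map (boxMk k n q) = ⊥ := by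
  rw [← le_bot_iff, Ideal.map_le_iff_le_comap]
  intro x hx
  rw [Ideal.mem_comap, (boxMk_eq_zero_iff k).mpr hx]
  exact Ideal.zero_mem _

/-- The polynomial `x₁² + ⋯ + xₙ²`. -/
def sumSq (n : ℕ) : MvPolynomial (Fin n) k := ∑ i, (MvPolynomial.X i) ^ 2

/-- The class of `x₁² + ⋯ + xₙ²` in the truncated polynomial ring. -/
def boxSumSq (n q : ℕ) : BoxRing k n q := boxMk k n q (sumSq k n)

/-- The dimension of `k[x₁, …, xₙ] / (x₁^q, …, xₙ^q, (x₁² + ⋯ + xₙ²)^a)`. -/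
def boxDim (n q a : ℕ) : ℕ := Module.finrank k (BoxRing k n q ⧸ Ideal.span {boxSumSq k n q ^ a})

theorem boxDim_eq_finrank (n q a : ℕ) :
    boxDim k n q a = Module.finrank k (MvPolynomial (Fin n) k ⧸ Ideal.span
      (Set.range (fun i => (MvPolynomial.X i : MvPolynomial (Fin n) k) ^ q) ∪ {sumSq k n ^ a})) := by
  have h : boxIdeal k n q ≤ Ideal.span
      (Set.range (fun i => (MvPolynomial.X i : MvPolynomial (Fin n) k) ^ q) ∪ {sumSq k n ^ a}) :=
    Ideal.span_mono Set.subset_union_left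
  have h2 : Ideal.map (boxMk k n q) (Ideal.span
      (Set.range (fun i => (MvPolynomial.X i : MvPolynomial (Fin n) k) ^ q) ∪ {sumSq k n ^ a})) =
      Ideal.span {boxSumSq k n q ^ a} := by
    have h3 := map_boxMk_boxIdeal k n q
    rw [boxIdeal] at h3
    rw [Ideal.span_union, Ideal.map_sup, h3, bot_sup_eq, Ideal.map_span, Set.image_singleton,
      map_pow]
    rfl
  rw [boxDim, finrank_quotient_map_of_surjective (boxMk k n q) (boxMk_surjective k n q) _
    ((ker_boxMk_le k n q).trans h), h2]

/-- Adjoining one variable to the truncated polynomial ring. -/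
def boxSucc (n q : ℕ) : MvPolynomial (Fin (n + 1)) k →ₐ[k] (BoxRing k n q)[X] :=
  (Polynomial.mapAlgHom (boxMk k n q)).comp
    (AlgEquiv.toAlgHom (MvPolynomial.finSuccEquiv k n))

theorem boxSucc_surjective (n q : ℕ) : Function.Surjective (boxSucc k n q) := by
  refine Function.Surjective.comp (g := Polynomial.mapAlgHom (boxMk k n q))
    ?_ (MvPolynomial.finSuccEquiv k n).surjective
  exact Polynomial.map_surjective _ (boxMk_surjective k n q)

theorem boxSucc_X_zero (n q : ℕ) : boxSucc k n q (MvPolynomial.X 0) = X := by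
  simp [boxSucc, MvPolynomial.finSuccEquiv_X_zero]

theorem boxSucc_X_succ (n q : ℕ) (j : Fin n) :
    boxSucc k n q (MvPolynomial.X j.succ) = C (boxMk k n q (MvPolynomial.X j)) := by
  simp [boxSucc, MvPolynomial.finSuccEquiv_X_succ]

theorem boxSucc_sumSq (n q : ℕ) :
    boxSucc k n q (sumSq k (n + 1)) = X ^ 2 + C (boxSumSq k n q) := by
  simp only [sumSq, boxSumSq, Fin.sum_univ_succ, map_add, map_sum, map_pow, boxSucc_X_zero,
    boxSucc_X_succ]

theorem ker_boxSucc_le (n q : ℕ) : RingHom.ker (boxSucc k n q) ≤ boxIdeal k (n + 1) q := by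
  intro g hg
  set e := MvPolynomial.finSuccEquiv k n with he
  have h1 : e g ∈ Ideal.map C (boxIdeal k n q) := by
    rw [Ideal.mem_map_C_iff]
    intro m
    have := congrArg (fun r => Polynomial.coeff r m) (RingHom.mem_ker.mp hg)
    simpa [boxSucc, boxMk_eq_zero_iff] using this
  have h2 : Ideal.map C (boxIdeal k n q) ≤
      (boxIdeal k (n + 1) q).comap (e.symm : _ →+* MvPolynomial (Fin (n + 1)) k) := by
    rw [boxIdeal, Ideal.map_span, Ideal.span_le]
    rintro _ ⟨_, ⟨i, rfl⟩, rfl⟩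
    have : e.symm (C (MvPolynomial.X i ^ q)) = MvPolynomial.X i.succ ^ q := by
      rw [AlgEquiv.symm_apply_eq, map_pow, map_pow, he, MvPolynomial.finSuccEquiv_X_succ]
    change (e.symm (C (MvPolynomial.X i ^ q))) ∈ boxIdeal k (n + 1) q
    rw [this]
    exact Ideal.subset_span ⟨i.succ, rfl⟩
  have h3 := h2 h1
  change (e.symm (e g)) ∈ boxIdeal k (n + 1) q at h3
  rwa [AlgEquiv.symm_apply_apply] at h3

theorem map_boxSucc_boxIdeal (n q : ℕ) :
    (boxIdeal k (n + 1) q).map (boxSucc k n q) = Ideal.span {X ^ q} := by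
  have h : boxIdeal k (n + 1) q = Ideal.span (Set.range fun i => (MvPolynomial.X i) ^ q) := rfl
  rw [h, Ideal.map_span]
  apply le_antisymm
  · rw [Ideal.span_le]
    rintro _ ⟨_, ⟨i, rfl⟩, rfl⟩
    refine Fin.cases ?_ (fun j => ?_) i
    · simp only [map_pow, boxSucc_X_zero]
      exact Ideal.subset_span rfl
    · simp only [map_pow, boxSucc_X_succ]
      rw [← C_pow, ← map_pow, (boxMk_eq_zero_iff k).mpr (X_pow_mem_boxIdeal k j), C_0]
      exact Ideal.zero_mem _
  · rw [Ideal.span_le, Set.singleton_subset_iff]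
    refine Ideal.subset_span ⟨_, ⟨0, rfl⟩, ?_⟩
    simp only [map_pow, boxSucc_X_zero]

theorem nonempty_boxRing_succ_equiv (n q : ℕ) :
    Nonempty (BoxRing k (n + 1) q ≃ₗ[k] (BoxRing k n q)[X] ⧸ Ideal.span {(X : (BoxRing k n q)[X]) ^ q}) := by
  have h := nonempty_quotient_equiv_map (boxSucc k n q) (boxSucc_surjective k n q) _ (ker_boxSucc_le k n q)
  rwa [map_boxSucc_boxIdeal] at h

theorem boxDim_succ (n q a : ℕ) :
    boxDim k (n + 1) q a = Module.finrank k ((BoxRing k n q)[X] ⧸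
      Ideal.span {(X : (BoxRing k n q)[X]) ^ q, (X ^ 2 + C (boxSumSq k n q)) ^ a}) := by
  have h := finrank_quotient_map_of_surjective (boxSucc k n q) (boxSucc_surjective k n q)
    (Ideal.span (Set.range (fun i => (MvPolynomial.X i : MvPolynomial (Fin (n + 1)) k) ^ q) ∪
      {sumSq k (n + 1) ^ a}))
    ((ker_boxSucc_le k n q).trans (Ideal.span_mono Set.subset_union_left))
  rw [boxDim_eq_finrank, h]
  have h2 : Ideal.map (boxSucc k n q)
      (Ideal.span (Set.range (fun i => (MvPolynomial.X i : MvPolynomial (Fin (n + 1)) k) ^ q) ∪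
        {sumSq k (n + 1) ^ a})) =
      Ideal.span {(X : (BoxRing k n q)[X]) ^ q, (X ^ 2 + C (boxSumSq k n q)) ^ a} := by
    have h3 := map_boxSucc_boxIdeal k n q
    rw [boxIdeal] at h3
    rw [Ideal.span_union, Ideal.map_sup, h3, Ideal.map_span, Set.image_singleton, map_pow,
      boxSucc_sumSq, ← Ideal.span_union, Set.singleton_union]
  rw [h2]

theorem module_finite_quotient_of_pow_mem {R : Type*} [CommRing R] [Algebra k R]
    [Module.Finite k R] {I : Ideal R[X]} {g : R[X]} (hg : g.Monic) (hI : g ∈ I) :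
    Module.Finite k (R[X] ⧸ I) := by
  have := hg.finite_quotient
  have : Module.Finite k (R[X] ⧸ Ideal.span {g}) := Module.Finite.trans R _
  exact Module.Finite.of_surjective
    (Ideal.Quotient.factorₐ k ((Ideal.span_singleton_le_iff_mem I).mpr hI)).toLinearMap
    (Ideal.Quotient.factor_surjective ((Ideal.span_singleton_le_iff_mem I).mpr hI))

theorem finrank_quotient_span_monic {R : Type*} [CommRing R] [Nontrivial R] [Algebra k R] {g : R[X]}
    (hg : g.Monic) :
    Module.finrank k (R[X] ⧸ Ideal.span {g}) = g.natDegree * Module.finrank k R := by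
  have := hg.free_quotient
  rw [← Module.finrank_mul_finrank k R, finrank_quotient_span_eq_natDegree' hg, mul_comm]

theorem boxIdeal_ne_top (n : ℕ) {q : ℕ} (hq : 0 < q) : boxIdeal k n q ≠ ⊤ := by
  intro h
  have h1 : boxIdeal k n q ≤ RingHom.ker (MvPolynomial.eval (0 : Fin n → k)) := by
    rw [boxIdeal, Ideal.span_le]
    rintro _ ⟨i, rfl⟩
    simp [hq.ne']
  have h2 := h1 (h ▸ Submodule.mem_top : (1 : MvPolynomial (Fin n) k) ∈ _)
  simp at h2

theorem boxIdeal_zero (q : ℕ) : boxIdeal k 0 q = ⊥ := by simp [boxIdeal]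

/-- In zero variables the truncated polynomial ring is the base field. -/
def boxRingZeroEquiv (q : ℕ) : BoxRing k 0 q ≃ₗ[k] k :=
  (((Ideal.quotientEquivAlgOfEq k (boxIdeal_zero k q)).trans (AlgEquiv.quotientBot k _)).trans
    (MvPolynomial.isEmptyAlgEquiv k (Fin 0))).toLinearEquiv

theorem nontrivial_boxRing (n : ℕ) {q : ℕ} (hq : 0 < q) : Nontrivial (BoxRing k n q) :=
  Ideal.Quotient.nontrivial_iff.mpr (boxIdeal_ne_top k n hq)

theorem finrank_boxRing (n : ℕ) {q : ℕ} (hq : 0 < q) :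
    Module.Finite k (BoxRing k n q) ∧ Module.finrank k (BoxRing k n q) = q ^ n := by
  induction n with
  | zero =>
    let e := boxRingZeroEquiv k q
    exact ⟨Module.Finite.equiv e.symm, by rw [e.finrank_eq]; simp⟩
  | succ n ih =>
    obtain ⟨h1, h2⟩ := ih
    obtain ⟨e⟩ := nonempty_boxRing_succ_equiv k n q
    have := nontrivial_boxRing k n hq
    have hm : (X ^ q : (BoxRing k n q)[X]).Monic := monic_X_pow q
    have := module_finite_quotient_of_pow_mem k hm (Ideal.mem_span_singleton_self _)
    refine ⟨Module.Finite.equiv e.symm, ?_⟩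
    rw [e.finrank_eq, finrank_quotient_span_monic k hm, h2, natDegree_X_pow, pow_succ, mul_comm]

/-- By Frobenius the p-th power is the sum of the (x_i^p)². This provides the boundary values of the
wave equation at a = p. -/
theorem boxSumSq_pow_expChar (p n : ℕ) [Fact p.Prime] [CharP k p] : boxSumSq k n p ^ p = 0 := by
  rw [boxSumSq, ← map_pow, boxMk_eq_zero_iff, sumSq, sum_pow_char]
  refine Ideal.sum_mem _ fun i _ => ?_
  rw [← pow_mul, mul_comm, pow_mul]
  exact Ideal.pow_mem_of_mem _ (X_pow_mem_boxIdeal k i) _ two_pos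

theorem boxDim_zero_vars (q a : ℕ) (ha : 0 < a) : boxDim k 0 q a = 1 := by
  let e := boxRingZeroEquiv k q
  have h0 : boxSumSq k 0 q ^ a = 0 := by simp [boxSumSq, sumSq, ha.ne']
  rw [boxDim, h0, Ideal.span_singleton_zero,
    ((AlgEquiv.quotientBot k (BoxRing k 0 q)).toLinearEquiv.trans e).finrank_eq]
  simp

theorem boxDim_pow_zero (n q : ℕ) : boxDim k n q 0 = 0 := by
  rw [boxDim, pow_zero, Ideal.span_singleton_one]
  exact Module.finrank_zero_of_subsingleton

end Recursion

end

noncomputable section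

section QuotientDimension

variable {k S V : Type*} [Field k] [CommRing S] [Algebra k S] [AddCommGroup V] [Module k V]

theorem finrank_quotient_eq_of_mem_iff {J : Ideal S} (φ : S →ₗ[k] V) (hφ : Function.Surjective φ)
    (hJ : ∀ x, x ∈ J ↔ φ x = 0) : Module.finrank k (S ⧸ J) = Module.finrank k V := by
  have h : J.restrictScalars k = LinearMap.ker φ := by
    ext x
    simp [hJ]
  exact ((Submodule.Quotient.restrictScalarsEquiv k J).symm.trans
    ((Submodule.quotEquivOfEq _ _ h).trans (φ.quotKerEquivOfSurjective hφ))).finrank_eq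

end QuotientDimension

/-! ### The discrete wave equation -/

section Wave

variable {k A : Type*} [Field k] [CommRing A] [Algebra k A]

/-- The map `(s, t) ↦ (s - c z t, t)` to `A / (Y, z^(a+1)) × A / (Y, z^(a-1))`; it identifies
`A[ε] / (Y, (z + ε)^a)` with this product if `c = 1 / a`. -/
def dualQuotientMap (Y z : A) (c : k) (a : ℕ) :
    (A × A) →ₗ[k] (A ⧸ Ideal.span {Y, z ^ (a + 2)}) × (A ⧸ Ideal.span {Y, z ^ a}) :=
  LinearMap.prod
    ((Ideal.Quotient.mkₐ k (Ideal.span {Y, z ^ (a + 2)})).toLinearMap ∘ₗ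
      (LinearMap.fst k A A - (LinearMap.mulLeft k (c • z)) ∘ₗ LinearMap.snd k A A))
    ((Ideal.Quotient.mkₐ k (Ideal.span {Y, z ^ a})).toLinearMap ∘ₗ LinearMap.snd k A A)

theorem dualQuotientMap_surjective (Y z : A) (c : k) (a : ℕ) :
    Function.Surjective (dualQuotientMap Y z c a) := by
  rintro ⟨x, y⟩
  obtain ⟨x, rfl⟩ := Ideal.Quotient.mk_surjective x
  obtain ⟨y, rfl⟩ := Ideal.Quotient.mk_surjective y
  refine ⟨(x + (c • z) * y, y), ?_⟩
  simp [dualQuotientMap]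

/-- The right-hand side says that s + εt lies in the ideal (Y, (z + ε)^(a+1)) of A[ε], because (z +
ε)^(a+1) = z^(a+1) + (a+1) z^a ε. The exponent is a + 1 here, so c inverts a + 1. -/
theorem dualQuotientMap_eq_zero_iff (Y z : A) {c : k} {a : ℕ} (hc : ((a : k) + 1) * c = 1)
    (s t : A) : dualQuotientMap Y z c a (s, t) = 0 ↔
      ∃ u u' v v', s = Y * u + z ^ (a + 1) * v ∧
        t = Y * u' + z ^ (a + 1) * v' + (a + 1) * z ^ a * v := by
  have hc' : ((a : A) + 1) * algebraMap k A c = 1 := by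
    have := congrArg (algebraMap k A) hc
    simpa using this
  have h1 : dualQuotientMap Y z c a (s, t) = 0 ↔
      s - algebraMap k A c * z * t ∈ Ideal.span {Y, z ^ (a + 2)} ∧ t ∈ Ideal.span {Y, z ^ a} := by
    simp only [← Ideal.Quotient.eq_zero_iff_mem, ← Algebra.smul_def]
    simp [dualQuotientMap]
  rw [h1, Ideal.mem_span_pair, Ideal.mem_span_pair]
  set C := algebraMap k A c
  constructor
  · rintro ⟨⟨g, d, hs⟩, ⟨u', w, ht⟩⟩
    refine ⟨C * z * u' + g, u', C * w + z * d, - (a + 1) * d, ?_, ?_⟩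
    · rw [← ht] at hs
      linear_combination -hs
    · linear_combination -ht - z ^ a * w * hc'
  · rintro ⟨u, u', v, v', rfl, rfl⟩
    refine ⟨⟨u - C * z * u', - C * v', ?_⟩, ⟨u', (z * v' + (a + 1) * v), ?_⟩⟩
    · linear_combination z ^ (a + 1) * v * hc'
    · ring

/-- The ring automorphism s ↦ s + εDs, ε ↦ -ε of A[ε] sends y to y + ε and z + ε to z. Hence it
carries (y^(m+1), (z + ε)^(a+1)) into ((y + ε)^(m+1), z^(a+1)). -/
theorem dualQuotientMap_derivation (D : Derivation k A A) {y z : A} (hy : D y = 1) (hz : D z = 1)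
    {c d : k} {m a : ℕ} (hc : ((a : k) + 1) * c = 1) (hd : ((m : k) + 1) * d = 1) {s t : A}
    (h : dualQuotientMap (y ^ (m + 1)) z c a (s, t) = 0) :
    dualQuotientMap (z ^ (a + 1)) y d m (s, D s - t) = 0 := by
  rw [dualQuotientMap_eq_zero_iff _ _ hc] at h
  rw [dualQuotientMap_eq_zero_iff _ _ hd]
  obtain ⟨u, u', v, v', hs, ht⟩ := h
  refine ⟨v, D v - v', u, D u - u', by rw [hs]; ring, ?_⟩
  have h1 : D (y ^ (m + 1)) = (m + 1) * y ^ m := by simp [Derivation.leibniz_pow, hy]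
  have h2 : D (z ^ (a + 1)) = (a + 1) * z ^ a := by simp [Derivation.leibniz_pow, hz]
  rw [hs, ht, map_add, Derivation.leibniz, Derivation.leibniz, h1, h2]
  simp only [smul_eq_mul]
  ring

/-- The discrete wave equation for the dimensions of `A / (y^m, z^a)`. -/
theorem finrank_quotient_span_pow_pair_wave (D : Derivation k A A) {y z : A} (hy : D y = 1)
    (hz : D z = 1) {m a : ℕ} (hm : (m : k) + 1 ≠ 0) (ha : (a : k) + 1 ≠ 0)
    (hfin : ∀ i j, Module.Finite k (A ⧸ Ideal.span {y ^ i, z ^ j})) :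
    Module.finrank k (A ⧸ Ideal.span {y ^ (m + 2), z ^ (a + 1)}) +
      Module.finrank k (A ⧸ Ideal.span {y ^ m, z ^ (a + 1)}) =
    Module.finrank k (A ⧸ Ideal.span {y ^ (m + 1), z ^ (a + 2)}) +
      Module.finrank k (A ⧸ Ideal.span {y ^ (m + 1), z ^ a}) := by
  have hc := mul_inv_cancel₀ ha
  have hd := mul_inv_cancel₀ hm
  let φ₁ := dualQuotientMap (y ^ (m + 1)) z ((a : k) + 1)⁻¹ a
  let φ₂ := dualQuotientMap (z ^ (a + 1)) y ((m : k) + 1)⁻¹ m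
  let θ : (A × A) →ₗ[k] (A × A) :=
    LinearMap.prod (LinearMap.fst k A A)
      (D.toLinearMap ∘ₗ LinearMap.fst k A A - LinearMap.snd k A A)
  have hθ : ∀ x, θ x = (x.1, D x.1 - x.2) := fun x => rfl
  have hθθ : θ ∘ₗ θ = LinearMap.id := by
    ext x <;> simp [hθ]
  let e : (A × A) ≃ₗ[k] (A × A) := LinearEquiv.ofLinearMap θ θ hθθ hθθ
  -- The automorphism is an involution, so the reverse inclusion is the same lemma with y and z
  -- exchanged.
  have hmap : (LinearMap.ker φ₁).map (e : (A × A) →ₗ[k] (A × A)) = LinearMap.ker φ₂ := by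
    apply le_antisymm
    · rintro _ ⟨⟨s, t⟩, hx, rfl⟩
      exact dualQuotientMap_derivation D hy hz hc hd hx
    · rintro ⟨s, t⟩ hx
      refine ⟨(s, D s - t), dualQuotientMap_derivation D hz hy hd hc hx, ?_⟩
      change θ (s, D s - t) = (s, t)
      simp [hθ]
  have key : Module.finrank k ((A × A) ⧸ LinearMap.ker φ₁) =
      Module.finrank k ((A × A) ⧸ LinearMap.ker φ₂) :=
    (Submodule.Quotient.equiv _ _ e hmap).finrank_eq
  rw [(φ₁.quotKerEquivOfSurjective (dualQuotientMap_surjective _ _ _ _)).finrank_eq,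
    (φ₂.quotKerEquivOfSurjective (dualQuotientMap_surjective _ _ _ _)).finrank_eq,
    Set.pair_comm (z ^ (a + 1)), Set.pair_comm (z ^ (a + 1))] at key
  rw [Module.finrank_prod, Module.finrank_prod] at key
  exact key.symm

end Wave

/-! ### The dimensions of R[X] / (X^m, (X + T)^a) -/

section SyzygyDimension

open Polynomial

variable (k : Type*) {R : Type*} [Field k] [CommRing R] [Algebra k R]

/-- The dimension of `R[X] / (X^m, (X + T)^a)`. -/
def shiftDim (T : R) (m a : ℕ) : ℕ :=
  Module.finrank k (R[X] ⧸ Ideal.span {(X : R[X]) ^ m, (X + C T) ^ a})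

theorem shiftDim_zero_left (T : R) (a : ℕ) : shiftDim k T 0 a = 0 := by
  have : Ideal.span {(X : R[X]) ^ 0, (X + C T) ^ a} = ⊤ :=
    Ideal.eq_top_of_isUnit_mem _ (Ideal.subset_span (Set.mem_insert _ _)) (by simp)
  rw [shiftDim, this]
  exact Module.finrank_zero_of_subsingleton

theorem shiftDim_zero_right (T : R) (m : ℕ) : shiftDim k T m 0 = 0 := by
  have : Ideal.span {(X : R[X]) ^ m, (X + C T) ^ 0} = ⊤ :=
    Ideal.eq_top_of_isUnit_mem _ (Ideal.subset_span (Set.mem_insert_of_mem _ rfl)) (by simp)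
  rw [shiftDim, this]
  exact Module.finrank_zero_of_subsingleton

theorem shiftDim_one_left (T : R) (a : ℕ) :
    shiftDim k T 1 a = Module.finrank k (R ⧸ Ideal.span {T ^ a}) := by
  let ψ : R[X] →ₐ[k] R := (Polynomial.aeval (0 : R)).restrictScalars k
  have hψ : ∀ g, ψ g = g.eval 0 := fun g => by simp [ψ, Polynomial.aeval_def, Polynomial.eval₂_eq_eval_map]
  have hs : Function.Surjective ψ := fun r => ⟨C r, by simp [hψ]⟩
  have hk : RingHom.ker ψ ≤ Ideal.span {(X : R[X]) ^ 1, (X + C T) ^ a} := by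
    intro g hg
    rw [RingHom.mem_ker, hψ, ← coeff_zero_eq_eval_zero] at hg
    rw [pow_one]
    exact Ideal.mem_of_dvd _ (X_dvd_iff.mpr hg) (Ideal.subset_span (Set.mem_insert _ _))
  have hmap : Ideal.map ψ (Ideal.span {(X : R[X]) ^ 1, (X + C T) ^ a}) = Ideal.span {T ^ a} := by
    rw [Ideal.map_span, Set.image_pair]
    simp [hψ]
  rw [shiftDim, finrank_quotient_map_of_surjective ψ hs _ hk, hmap]

theorem module_finite_quotient_shift [Module.Finite k R] (T : R) (i j : ℕ) :
    Module.Finite k (R[X] ⧸ Ideal.span {(X : R[X]) ^ i, (X + C T) ^ j}) :=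
  module_finite_quotient_of_pow_mem k (monic_X_pow i) (Ideal.subset_span (Set.mem_insert _ _))

theorem shiftDim_wave [Module.Finite k R] (T : R) {m a : ℕ} (hm : (m : k) + 1 ≠ 0)
    (ha : (a : k) + 1 ≠ 0) :
    shiftDim k T (m + 2) (a + 1) + shiftDim k T m (a + 1) =
      shiftDim k T (m + 1) (a + 2) + shiftDim k T (m + 1) a :=
  finrank_quotient_span_pow_pair_wave
    ((Polynomial.derivative' (R := R)).restrictScalars k) (by simp) (by simp) hm ha
    (module_finite_quotient_shift k T)

/-- Here (X + T)^p = X^p is redundant next to X^m, leaving a free R-module of rank m. -/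
theorem shiftDim_char (p : ℕ) [Fact p.Prime] [CharP k p] {T : R} (hT : T ^ p = 0) {m : ℕ}
    (hm : m ≤ p) : shiftDim k T m p = m * Module.finrank k R := by
  cases subsingleton_or_nontrivial R with
  | inl h =>
    rw [shiftDim, Module.finrank_zero_of_subsingleton, Module.finrank_zero_of_subsingleton,
      mul_zero]
  | inr h =>
    have : CharP R p := charP_of_injective_algebraMap (algebraMap k R).injective p
    have h1 : ((X : R[X]) + C T) ^ p = X ^ p := by
      rw [add_pow_char, ← C_pow, hT, C_0, add_zero]
    have h2 : Ideal.span {(X : R[X]) ^ m, (X + C T) ^ p} = Ideal.span {X ^ m} := by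
      rw [h1, Ideal.span_insert, sup_eq_left, Ideal.span_singleton_le_span_singleton]
      exact pow_dvd_pow _ hm
    rw [shiftDim, h2, finrank_quotient_span_monic k (monic_X_pow m), natDegree_X_pow]

/-- Write g = e(X²) + X o(X²). The generator (X² + T)^a respects this splitting, while X^(2h+1) = X
(X²)^h exchanges the parts. It therefore contributes X^h to the odd part and, after multiplication
by X, X^(h+1) to the even part. -/
theorem mem_span_sq_iff (T : R) (h a : ℕ) (g : R[X]) :
    g ∈ Ideal.span {(X : R[X]) ^ (2 * h + 1), (X ^ 2 + C T) ^ a} ↔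
      contract 2 g ∈ Ideal.span {(X : R[X]) ^ (h + 1), (X + C T) ^ a} ∧
      contract 2 (divX g) ∈ Ideal.span {(X : R[X]) ^ h, (X + C T) ^ a} := by
  have hexp : ((X : R[X]) ^ 2 + C T) ^ a = expand R 2 ((X + C T) ^ a) := by simp
  have hX : (X : R[X]) ^ (2 * h + 1) = X * expand R 2 (X ^ h) := by
    simp only [map_pow, expand_X]
    ring
  have hodd : ∀ u : R[X], contract 2 (X * u) = X * contract 2 (divX u) := by
    intro u
    ext n
    rw [coeff_contract two_ne_zero]
    cases n with
    | zero => simp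
    | succ n => rw [coeff_X_mul, coeff_contract two_ne_zero, coeff_divX, add_mul, one_mul,
        show n * 2 + 2 = (n * 2 + 1) + 1 from rfl, coeff_X_mul]
  -- Deduced from the even part of X times the polynomial by cancelling the regular element X.
  have hoddmul : ∀ u v : R[X], contract 2 (divX (u * expand R 2 v)) = contract 2 (divX u) * v := by
    intro u v
    have := hodd (u * expand R 2 v)
    rw [← mul_assoc, contract_mul_expand two_ne_zero, hodd, mul_assoc] at this
    exact (Polynomial.monic_X.isRegular.left this).symm
  have hdec : g = expand R 2 (contract 2 g) + X * expand R 2 (contract 2 (divX g)) := by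
    ext n
    obtain ⟨j, rfl | rfl⟩ := Nat.even_or_odd' n
    · rw [coeff_add, coeff_expand two_pos, if_pos (by simp), coeff_contract two_ne_zero]
      cases j with
      | zero => simp
      | succ j =>
        rw [show 2 * (j + 1) = (2 * j + 1) + 1 by ring, coeff_X_mul, coeff_expand two_pos,
          if_neg (by omega), add_zero]
        congr 1
        omega
    · rw [coeff_add, coeff_expand two_pos, if_neg (by omega), zero_add, coeff_X_mul,
        coeff_expand two_pos, if_pos (by simp), coeff_contract two_ne_zero, coeff_divX]
      congr 1
      omega
  rw [hX, hexp]
  constructor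
  · intro hg
    obtain ⟨u, v, rfl⟩ := Ideal.mem_span_pair.mp hg
    rw [← mul_assoc]
    refine ⟨Ideal.mem_span_pair.mpr ⟨contract 2 (divX u), contract 2 v, ?_⟩,
      Ideal.mem_span_pair.mpr ⟨contract 2 u, contract 2 (divX v), ?_⟩⟩
    · rw [contract_add two_ne_zero, contract_mul_expand two_ne_zero,
        contract_mul_expand two_ne_zero, mul_comm u, hodd]
      ring
    · rw [divX_add, contract_add two_ne_zero, hoddmul, hoddmul]
      congr 2
      congr 1
      ext n
      rw [coeff_divX, coeff_mul_X]
  · rintro ⟨h1, h2⟩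
    obtain ⟨u, v, huv⟩ := Ideal.mem_span_pair.mp h1
    obtain ⟨u', v', huv'⟩ := Ideal.mem_span_pair.mp h2
    rw [hdec, ← huv, ← huv']
    refine Ideal.mem_span_pair.mpr ⟨X * expand R 2 u + expand R 2 u',
      expand R 2 v + X * expand R 2 v', ?_⟩
    simp only [map_add, map_mul, map_pow, expand_X, expand_C]
    ring

theorem finrank_quotient_span_sq [Module.Finite k R] (T : R) (h a : ℕ) :
    Module.finrank k (R[X] ⧸ Ideal.span {(X : R[X]) ^ (2 * h + 1), (X ^ 2 + C T) ^ a}) =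
      shiftDim k T (h + 1) a + shiftDim k T h a := by
  let ev : R[X] →ₗ[R] R[X] :=
    { toFun := contract 2
      map_add' := contract_add two_ne_zero
      map_smul' := fun r g => by ext n; simp [coeff_contract two_ne_zero] }
  let od : R[X] →ₗ[R] R[X] :=
    { toFun := fun g => contract 2 (divX g)
      map_add' := fun f g => by rw [divX_add, contract_add two_ne_zero]
      map_smul' := fun r g => by ext n; simp [coeff_contract two_ne_zero, coeff_divX] }
  let φ : R[X] →ₗ[k] (R[X] ⧸ Ideal.span {(X : R[X]) ^ (h + 1), (X + C T) ^ a}) ×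
      (R[X] ⧸ Ideal.span {(X : R[X]) ^ h, (X + C T) ^ a}) :=
    LinearMap.prod ((Ideal.Quotient.mkₐ k _).toLinearMap ∘ₗ ev.restrictScalars k)
      ((Ideal.Quotient.mkₐ k _).toLinearMap ∘ₗ od.restrictScalars k)
  have hφ : ∀ g, φ g = (Ideal.Quotient.mk _ (contract 2 g),
    Ideal.Quotient.mk _ (contract 2 (divX g))) := fun g => rfl
  have := module_finite_quotient_shift k T (h + 1) a
  have := module_finite_quotient_shift k T h a
  rw [finrank_quotient_eq_of_mem_iff φ, Module.finrank_prod, shiftDim, shiftDim]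
  · rintro ⟨x, y⟩
    obtain ⟨x, rfl⟩ := Ideal.Quotient.mk_surjective x
    obtain ⟨y, rfl⟩ := Ideal.Quotient.mk_surjective y
    refine ⟨expand R 2 x + X * expand R 2 y, ?_⟩
    have h1 : contract 2 (expand R 2 x + X * expand R 2 y) = x := by
      ext n
      rw [coeff_contract two_ne_zero, coeff_add, coeff_expand_mul two_pos]
      cases n with
      | zero => simp
      | succ n =>
        rw [add_mul, one_mul, show n * 2 + 2 = (n * 2 + 1) + 1 from rfl, coeff_X_mul,
          coeff_expand two_pos, if_neg (by omega), add_zero]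
    have h2 : contract 2 (divX (expand R 2 x + X * expand R 2 y)) = y := by
      ext n
      rw [coeff_contract two_ne_zero, coeff_divX, coeff_add, coeff_X_mul,
        coeff_expand_mul two_pos, coeff_expand two_pos, if_neg (by omega), zero_add]
    rw [hφ, h1, h2]
  · intro g
    rw [mem_span_sq_iff, hφ, Prod.mk_eq_zero, Ideal.Quotient.eq_zero_iff_mem,
      Ideal.Quotient.eq_zero_iff_mem]

end SyzygyDimension

end

noncomputable section

/-! ### Solving the discrete wave equation -/

section WaveSum

/-- The solution `∑_{r < m} F (b + m - 1 - 2r)` of the discrete wave equation. -/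
def waveSum (F : ℤ → ℤ) (m : ℕ) (b : ℤ) : ℤ := ∑ r ∈ Finset.range m, F (b + m - 1 - 2 * r)

/-- Splitting off the last summand, F(b - m - 1), from one sum on each side leaves identical terms.
-/
theorem waveSum_add_two (F : ℤ → ℤ) (m : ℕ) (b : ℤ) :
    waveSum F (m + 2) b + waveSum F m b = waveSum F (m + 1) (b + 1) + waveSum F (m + 1) (b - 1) := by
  have h1 : waveSum F (m + 2) b = waveSum F (m + 1) (b + 1) + F (b - (m + 1)) := by
    rw [waveSum, Finset.sum_range_succ, waveSum]
    congr 1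
    · refine Finset.sum_congr rfl fun r _ => ?_
      congr 1
      push_cast
      ring
    · congr 1
      push_cast
      ring
  have h2 : waveSum F (m + 1) (b - 1) = waveSum F m b + F (b - (m + 1)) := by
    rw [waveSum, Finset.sum_range_succ, waveSum]
    congr 1
    · refine Finset.sum_congr rfl fun r _ => ?_
      congr 1
      push_cast
      ring
    · congr 1
      push_cast
      ring
  rw [h1, h2]
  ring

/-- The summation points are symmetric about c, so adding the sum to its reversal pairs them up.
With c = 0 and c = p this matches the two edges of the strip 0 ≤ a ≤ p. -/
theorem waveSum_eq_mul_of_symm {F : ℤ → ℤ} {c N : ℤ} (h : ∀ b, F (c + b) + F (c - b) = 2 * N)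
    (m : ℕ) : waveSum F m c = m * N := by
  have h1 : waveSum F m c + waveSum F m c = m * (2 * N) := by
    have h2 : waveSum F m c = ∑ r ∈ Finset.range m, F (c - (m - 1 - 2 * r)) := by
      rw [waveSum, ← Finset.sum_range_reflect]
      refine Finset.sum_congr rfl fun r hr => ?_
      rw [Finset.mem_range] at hr
      congr 1
      omega
    nth_rewrite 2 [h2]
    rw [waveSum, ← Finset.sum_add_distrib]
    trans ∑ r ∈ Finset.range m, (2 * N)
    · refine Finset.sum_congr rfl fun r _ => ?_
      rw [← h (m - 1 - 2 * r)]
      congr 2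
      ring
    · simp
  linarith

/-- Rows 0 and 1 together with the edges a = 0 and a = p determine every later row through the wave
equation. Oddness and quasi-periodicity of F make the d'Alembert sum take the right values on the
edges. -/
theorem eq_waveSum {p : ℕ} {F : ℤ → ℤ} {N : ℤ} (hodd : ∀ b, F (-b) = -F b)
    (hper : ∀ b, F (b + 2 * p) = F b + 2 * N) {X : ℕ → ℕ → ℤ} (hX0 : ∀ a, X 0 a = 0)
    (hX1 : ∀ a, a ≤ p → X 1 a = F a) (hzero : ∀ m, X m 0 = 0) (hp : ∀ m, m ≤ p → X m p = m * N)
    (hwave : ∀ m a, m + 1 < p → a + 1 < p →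
      X (m + 2) (a + 1) + X m (a + 1) = X (m + 1) (a + 2) + X (m + 1) a)
    {m : ℕ} (hm : m ≤ p) {a : ℕ} (ha : a ≤ p) : X m a = waveSum F m a := by
  induction m using Nat.strong_induction_on generalizing a with
  | _ m ih =>
  match m with
  | 0 => simp [hX0, waveSum]
  | 1 => simp [hX1 a ha, waveSum]
  | m + 2 =>
    rcases Nat.eq_zero_or_pos a with rfl | ha0
    · rw [hzero, Nat.cast_zero, waveSum_eq_mul_of_symm (N := 0), mul_zero]
      intro b
      rw [zero_add, zero_sub, hodd]
      ring
    rcases ha.eq_or_lt with rfl | hlt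
    · rw [hp _ hm, waveSum_eq_mul_of_symm (N := N)]
      intro b
      have h1 := hper (b - a)
      have h2 := hodd (a - b)
      rw [neg_sub] at h2
      rw [show (a : ℤ) + b = b - a + 2 * a by ring, h1, h2]
      ring
    · obtain ⟨a, rfl⟩ := Nat.exists_eq_add_of_lt ha0
      rw [zero_add] at *
      have h1 := hwave m a (by omega) (by omega)
      have h2 := waveSum_add_two F m ((a + 1 : ℕ) : ℤ)
      have h3 := ih m (by omega) (by omega) ha
      have h4 := ih (m + 1) (by omega) (by omega) (a := a + 2) (by omega)
      have h5 := ih (m + 1) (by omega) (by omega) (a := a) (by omega)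
      rw [show ((a + 1 : ℕ) : ℤ) + 1 = ((a + 2 : ℕ) : ℤ) by push_cast; ring,
        show ((a + 1 : ℕ) : ℤ) - 1 = (a : ℤ) by push_cast; ring] at h2
      linarith

theorem sum_range_two_mul_add_one (c : ℕ → ℤ) (m : ℕ) :
    ∑ j ∈ Finset.range (2 * m + 1), c j =
      ∑ r ∈ Finset.range (m + 1), c (2 * r) + ∑ r ∈ Finset.range m, c (2 * r + 1) := by
  induction m with
  | zero => simp
  | succ m ih =>
    rw [show 2 * (m + 1) + 1 = 2 * m + 1 + 1 + 1 by ring, Finset.sum_range_succ,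
      Finset.sum_range_succ, ih, Finset.sum_range_succ _ (m + 1), Finset.sum_range_succ _ m,
      Finset.sum_range_succ _ m]
    ring_nf

/-- Each sum advances in steps of 2. The two interleave into a window of 2h + 1 consecutive points
centred at b. -/
theorem waveSum_succ_add_waveSum (F : ℤ → ℤ) (h : ℕ) (b : ℤ) :
    waveSum F (h + 1) b + waveSum F h b = ∑ j ∈ Finset.range (2 * h + 1), F (b + h - j) := by
  rw [sum_range_two_mul_add_one, waveSum, waveSum]
  congr 1
  · refine Finset.sum_congr rfl fun r _ => ?_
    congr 1
    push_cast
    ring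
  · refine Finset.sum_congr rfl fun r _ => ?_
    congr 1
    push_cast
    ring

end WaveSum

/-! ### Iterated window sums and the dimensions they compute -/

section BoxSeq

/-- Iterated box sums of the function `b ↦ ⌈b / 2p⌉ + ⌊b / 2p⌋`. -/
def boxSeq (p : ℕ) : ℕ → ℤ → ℤ
  | 0, b => ⌈(b : ℚ) / (2 * p)⌉ + ⌊(b : ℚ) / (2 * p)⌋
  | n + 1, b => ∑ j ∈ Finset.range p, boxSeq p n (b + (p / 2 : ℕ) - j)

theorem boxSeq_add_two_mul {p : ℕ} (hp : 0 < p) (n : ℕ) (b : ℤ) :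
    boxSeq p n (b + 2 * p) = boxSeq p n b + 2 * p ^ n := by
  induction n generalizing b with
  | zero =>
    have h : ((b + 2 * p : ℤ) : ℚ) / (2 * p) = (b : ℚ) / (2 * p) + 1 := by
      push_cast
      field_simp
    rw [boxSeq, boxSeq, h, Int.ceil_add_one, Int.floor_add_one]
    ring
  | succ n ih =>
    rw [boxSeq, boxSeq]
    trans ∑ j ∈ Finset.range p, (boxSeq p n (b + (p / 2 : ℕ) - j) + 2 * p ^ n)
    · refine Finset.sum_congr rfl fun j _ => ?_
      rw [← ih]
      congr 1
      ring
    · rw [Finset.sum_add_distrib, Finset.sum_const, Finset.card_range, nsmul_eq_mul]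
      ring

theorem boxSeq_neg {p : ℕ} (hp : Odd p) (n : ℕ) (b : ℤ) : boxSeq p n (-b) = -boxSeq p n b := by
  induction n generalizing b with
  | zero =>
    rw [boxSeq, boxSeq, Int.cast_neg, neg_div, Int.ceil_neg, Int.floor_neg]
    ring
  | succ n ih =>
    rw [boxSeq, boxSeq, ← Finset.sum_range_reflect, ← Finset.sum_neg_distrib]
    refine Finset.sum_congr rfl fun j hj => ?_
    rw [← ih]
    rw [Finset.mem_range] at hj
    obtain ⟨h, rfl⟩ := hp
    congr 1
    omega

theorem boxSeq_zero_of_pos {p : ℕ} {b : ℤ} (h0 : 0 < b) (h1 : b < 2 * p) : boxSeq p 0 b = 1 := by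
  have hp : (0 : ℚ) < 2 * p := by exact_mod_cast h0.trans h1
  have hb : (0 : ℚ) < b := by exact_mod_cast h0
  have hb' : (b : ℚ) < 2 * p := by exact_mod_cast h1
  have h2 : ⌈(b : ℚ) / (2 * p)⌉ = 1 := by
    rw [Int.ceil_eq_iff]
    exact ⟨by simpa using div_pos hb hp, by simpa using ((div_lt_one hp).mpr hb').le⟩
  have h3 : ⌊(b : ℚ) / (2 * p)⌋ = 0 := by
    rw [Int.floor_eq_zero_iff]
    exact ⟨(div_pos hb hp).le, (div_lt_one hp).mpr hb'⟩
  rw [boxSeq, h2, h3, add_zero]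

theorem boxSeq_apply_zero {p : ℕ} (hp : Odd p) (n : ℕ) : boxSeq p n 0 = 0 := by
  have := boxSeq_neg hp n 0
  rw [neg_zero] at this
  omega

end BoxSeq

section BoxDim

variable (k : Type*) [Field k]

theorem boxDim_eq_boxSeq (p : ℕ) [Fact p.Prime] [CharP k p] (hp : Odd p) (n : ℕ) {a : ℕ}
    (ha : a ≤ p) : (boxDim k n p a : ℤ) = boxSeq p n a := by
  have hp0 := hp.pos
  -- The wave equation divides by m + 1 and a + 1, which is allowed strictly inside the strip.
  have hcast : ∀ j, j + 1 < p → (j : k) + 1 ≠ 0 := by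
    intro j hj h
    have : ((j + 1 : ℕ) : k) = 0 := by exact_mod_cast h
    rw [CharP.cast_eq_zero_iff k p] at this
    exact absurd (Nat.le_of_dvd (by omega) this) (by omega)
  induction n generalizing a with
  | zero =>
    rcases Nat.eq_zero_or_pos a with rfl | h0
    · rw [boxDim_pow_zero, Nat.cast_zero, boxSeq_apply_zero hp]
    · rw [boxDim_zero_vars k p a h0, boxSeq_zero_of_pos (by omega) (by omega)]
      rfl
  | succ n ih =>
    obtain ⟨hfin, hrank⟩ := finrank_boxRing k n hp0
    obtain ⟨h, hh⟩ := hp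
    have hwave : ∀ m ≤ p, (shiftDim k (boxSumSq k n p) m a : ℤ) = waveSum (boxSeq p n) m a :=
      fun m hm => eq_waveSum (p := p) (F := boxSeq p n) (N := p ^ n)
      (boxSeq_neg ⟨h, hh⟩ n) (boxSeq_add_two_mul hp0 n)
      (X := fun m a => (shiftDim k (boxSumSq k n p) m a : ℤ))
      (fun a => by rw [shiftDim_zero_left]; rfl)
      (fun a ha => by rw [shiftDim_one_left, ← ih ha]; rfl)
      (fun m => by rw [shiftDim_zero_right]; rfl)
      (fun m hm => by
        rw [shiftDim_char k p (boxSumSq_pow_expChar k p n) hm, hrank]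
        push_cast
        rfl)
      (fun m a hm ha => by
        exact_mod_cast shiftDim_wave k (boxSumSq k n p) (hcast m hm) (hcast a ha)) hm ha
    have h1 := finrank_quotient_span_sq k (boxSumSq k n p) h a
    rw [← hh] at h1
    rw [boxDim_succ, h1, Nat.cast_add, hwave _ (by omega), hwave _ (by omega),
      waveSum_succ_add_waveSum, boxSeq, ← hh, show p / 2 = h by omega]

end BoxDim

end

noncomputable section

/-! ### Compatibility with Frobenius -/

section FrobeniusPower

open MvPolynomial

variable (k : Type*) [Field k] (p : ℕ) {σ : Type*}

/-- The component of a polynomial `g` along `x^c` over the ring of polynomials in `x₁^p, …, xₙ^p`,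
where the exponents in `c` are less than `p`. -/
def expandComponent (c : σ →₀ ℕ) : MvPolynomial σ k →ₗ[k] MvPolynomial σ k :=
  open Classical in
  (basisMonomials σ k).constr k fun m =>
    if m.mapRange (· % p) (Nat.zero_mod p) = c then
      monomial (m.mapRange (· / p) (Nat.zero_div p)) 1 else 0

open Classical in
theorem expandComponent_monomial (c m : σ →₀ ℕ) (a : k) :
    expandComponent k p c (monomial m a) =
      if m.mapRange (· % p) (Nat.zero_mod p) = c then
        monomial (m.mapRange (· / p) (Nat.zero_div p)) a else 0 := by
  have h : monomial m a = a • basisMonomials σ k m := by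
    rw [coe_basisMonomials, smul_monomial, smul_eq_mul, mul_one]
  rw [h, map_smul, expandComponent, Module.Basis.constr_basis]
  split_ifs
  · rw [smul_monomial, smul_eq_mul, mul_one]
  · rw [smul_zero]

variable {p}

theorem expandComponent_mul_expand (hp : 0 < p) (c : σ →₀ ℕ) (g h : MvPolynomial σ k) :
    expandComponent k p c (g * expand p h) = expandComponent k p c g * h := by
  classical
  induction h using MvPolynomial.induction_on' with
  | add h₁ h₂ ih₁ ih₂ => rw [map_add, mul_add, map_add, ih₁, ih₂, mul_add]
  | monomial u b =>
    induction g using MvPolynomial.induction_on' with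
    | add g₁ g₂ ih₁ ih₂ => rw [add_mul, map_add, ih₁, ih₂, map_add, add_mul]
    | monomial m a =>
      have h1 : (m + p • u).mapRange (· % p) (Nat.zero_mod p) =
          m.mapRange (· % p) (Nat.zero_mod p) := by
        ext i
        simp
      have h2 : (m + p • u).mapRange (· / p) (Nat.zero_div p) =
          m.mapRange (· / p) (Nat.zero_div p) + u := by
        ext i
        simp [Nat.add_mul_div_left _ _ hp]
      rw [expand_monomial, monomial_mul, expandComponent_monomial, expandComponent_monomial, h1,
        h2]
      split_ifs
      · rw [monomial_mul]
      · rw [zero_mul]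

variable [Fintype σ]

/-- The exponent with entries given by `c`. -/
def residueExponent (c : σ → Fin p) : σ →₀ ℕ := Finsupp.equivFunOnFinite.symm fun i => (c i : ℕ)

theorem sum_monomial_mul_expand_expandComponent [DecidableEq σ] (hp : 0 < p) (g : MvPolynomial σ k) :
    ∑ c : σ → Fin p, monomial (residueExponent c) 1 *
      expand p (expandComponent k p (residueExponent c) g) = g := by
  classical
  induction g using MvPolynomial.induction_on' with
  | add g₁ g₂ ih₁ ih₂ =>
    simp only [map_add, mul_add, Finset.sum_add_distrib]
    rw [ih₁, ih₂]
  | monomial m a =>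
    let c₀ : σ → Fin p := fun i => ⟨m i % p, Nat.mod_lt _ hp⟩
    have h0 : m.mapRange (· % p) (Nat.zero_mod p) = residueExponent c₀ := by
      ext i
      simp [residueExponent, c₀]
    rw [Finset.sum_eq_single c₀]
    · rw [expandComponent_monomial, if_pos h0, expand_monomial, monomial_mul, one_mul]
      have hm : residueExponent c₀ + p • m.mapRange (· / p) (Nat.zero_div p) = m := by
        ext i
        simp [residueExponent, c₀, Nat.mod_add_div]
      rw [hm]
    · intro c _ hc
      rw [expandComponent_monomial, if_neg, map_zero, mul_zero]
      intro h
      apply hc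
      ext i
      have := DFunLike.congr_fun h i
      simpa [residueExponent, c₀] using this.symm
    · simp

theorem expandComponent_residueExponent (c c' : σ → Fin p) [DecidableEq (σ → Fin p)] :
    expandComponent k p (residueExponent c) (monomial (residueExponent c') 1) =
      if c' = c then 1 else 0 := by
  classical
  rw [expandComponent_monomial]
  have h1 : (residueExponent c').mapRange (· % p) (Nat.zero_mod p) = residueExponent c' := by
    ext i
    simp [residueExponent, Nat.mod_eq_of_lt (c' i).isLt]
  have h2 : (residueExponent c').mapRange (· / p) (Nat.zero_div p) = 0 := by
    ext i
    simp [residueExponent, Nat.div_eq_of_lt (c' i).isLt]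
  have h3 : residueExponent c' = residueExponent c ↔ c' = c := by
    constructor
    · intro h
      ext i
      exact DFunLike.congr_fun h i
    · rintro rfl
      rfl
  rw [h1, h2]
  simp only [h3]
  rfl

/-- The polynomial ring is free over its subring of polynomials in the x_i^p, with basis the
monomials whose exponents are below p. An ideal generated from the subring is thus tested on
coordinates. -/
theorem mem_span_image_expand_iff (hp : 0 < p) (S : Set (MvPolynomial σ k))
    (g : MvPolynomial σ k) : g ∈ Ideal.span (expand p '' S) ↔
      ∀ c : σ → Fin p, expandComponent k p (residueExponent c) g ∈ Ideal.span S := by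
  constructor
  · intro hg c
    -- The coordinate maps are linear only over the subring, so the induction has to carry an
    -- arbitrary multiplier.
    have key : ∀ a, expandComponent k p (residueExponent c) (a * g) ∈ Ideal.span S := by
      induction hg using Submodule.span_induction with
      | mem x hx =>
        obtain ⟨s, hs, rfl⟩ := hx
        intro a
        rw [expandComponent_mul_expand k hp]
        exact Ideal.mul_mem_left _ _ (Ideal.subset_span hs)
      | zero => simp
      | add x y _ _ hx hy =>
        intro a
        rw [mul_add, map_add]
        exact Ideal.add_mem _ (hx a) (hy a)
      | smul b x _ hx =>
        intro a
        rw [smul_eq_mul, ← mul_assoc]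
        exact hx _
    simpa using key 1
  · intro h
    classical
    rw [← sum_monomial_mul_expand_expandComponent k hp g]
    refine Ideal.sum_mem _ fun c _ => Ideal.mul_mem_left _ _ ?_
    have hle : Ideal.span S ≤ (Ideal.span (expand p '' S)).comap (expand p) := by
      rw [Ideal.span_le]
      intro s hs
      exact Ideal.subset_span ⟨s, hs, rfl⟩
    exact hle (h c)

theorem finrank_quotient_span_image_expand (hp : 0 < p) (S : Set (MvPolynomial σ k))
    [Module.Finite k (MvPolynomial σ k ⧸ Ideal.span S)] :
    Module.finrank k (MvPolynomial σ k ⧸ Ideal.span (expand p '' S)) =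
      p ^ Fintype.card σ * Module.finrank k (MvPolynomial σ k ⧸ Ideal.span S) := by
  classical
  let φ : MvPolynomial σ k →ₗ[k] ((σ → Fin p) → MvPolynomial σ k ⧸ Ideal.span S) :=
    LinearMap.pi fun c => (Ideal.Quotient.mkₐ k (Ideal.span S)).toLinearMap ∘ₗ
      expandComponent k p (residueExponent c)
  have hφ : ∀ g c, φ g c = Ideal.Quotient.mk _ (expandComponent k p (residueExponent c) g) :=
    fun g c => rfl
  rw [finrank_quotient_eq_of_mem_iff φ, Module.finrank_pi_fintype, Finset.sum_const,
    Finset.card_univ, Fintype.card_fun, Fintype.card_fin, smul_eq_mul]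
  · intro y
    choose g hg using fun c => Ideal.Quotient.mk_surjective (y c)
    refine ⟨∑ c, monomial (residueExponent c) 1 * expand p (g c), ?_⟩
    ext c
    rw [hφ, map_sum, ← hg c]
    congr 1
    rw [Finset.sum_eq_single c]
    · rw [expandComponent_mul_expand k hp, expandComponent_residueExponent, if_pos rfl, one_mul]
    · intro c' _ hc'
      rw [expandComponent_mul_expand k hp, expandComponent_residueExponent, if_neg hc', zero_mul]
    · simp
  · intro g
    rw [mem_span_image_expand_iff k hp, funext_iff]
    exact forall_congr' fun c => by
      rw [hφ, Pi.zero_apply, Ideal.Quotient.eq_zero_iff_mem]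

end FrobeniusPower

/-! ### Lipschitz bounds -/

section BoxDimBounds

variable (k : Type*) [Field k]

/-- Over the prime field g(x^p) = g^p, so substituting x_i^p for x_i multiplies all the exponents in
the ideal by p. -/
theorem boxDim_mul_prime (p : ℕ) [Fact p.Prime] (n : ℕ) {q : ℕ} (hq : 0 < q) (a : ℕ) :
    boxDim (ZMod p) n (p * q) (p * a) = p ^ n * boxDim (ZMod p) n q a := by
  have hp : 0 < p := (Fact.out : p.Prime).pos
  rw [boxDim_eq_finrank, boxDim_eq_finrank]
  have hfin : Module.Finite (ZMod p) (MvPolynomial (Fin n) (ZMod p) ⧸ boxIdeal (ZMod p) n q) :=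
    (finrank_boxRing (ZMod p) n hq).1
  have hle : boxIdeal (ZMod p) n q ≤ Ideal.span
      (Set.range (fun i => (MvPolynomial.X i : MvPolynomial (Fin n) (ZMod p)) ^ q) ∪
        {sumSq (ZMod p) n ^ a}) := Ideal.span_mono Set.subset_union_left
  have : Module.Finite (ZMod p) (MvPolynomial (Fin n) (ZMod p) ⧸ Ideal.span
      (Set.range (fun i => (MvPolynomial.X i : MvPolynomial (Fin n) (ZMod p)) ^ q) ∪
        {sumSq (ZMod p) n ^ a})) :=
    Module.Finite.of_surjective (Ideal.Quotient.factorₐ (ZMod p) hle).toLinearMap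
      (Ideal.Quotient.factor_surjective hle)
  have h := finrank_quotient_span_image_expand (ZMod p) hp
    (Set.range (fun i => (MvPolynomial.X i : MvPolynomial (Fin n) (ZMod p)) ^ q) ∪
        {sumSq (ZMod p) n ^ a})
  rw [Fintype.card_fin] at h
  rw [← h, Set.image_union, ← Set.range_comp, Set.image_singleton]
  have h1 : ((MvPolynomial.expand p) ∘ fun i => (MvPolynomial.X i : MvPolynomial (Fin n) (ZMod p)) ^ q)
      = fun i => (MvPolynomial.X i : MvPolynomial (Fin n) (ZMod p)) ^ (p * q) := by
    ext1 i
    simp [pow_mul]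
  have h2 : MvPolynomial.expand p (sumSq (ZMod p) n ^ a) = sumSq (ZMod p) n ^ (p * a) := by
    rw [MvPolynomial.expand_zmod, ← pow_mul, mul_comm]
  rw [h1, h2]

/-- Multiplication by T^a gives the exact sequence R/T → R/T^(a+1) → R/T^a → 0. -/
theorem finrank_quotient_span_pow_succ_le {R : Type*} [CommRing R] [Algebra k R]
    [Module.Finite k R] (T : R) (a : ℕ) :
    Module.finrank k (R ⧸ Ideal.span {T ^ (a + 1)}) ≤
      Module.finrank k (R ⧸ Ideal.span {T ^ a}) + Module.finrank k (R ⧸ Ideal.span {T}) := by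
  have hle : Ideal.span {T ^ (a + 1)} ≤ Ideal.span {T ^ a} := by
    rw [Ideal.span_singleton_le_span_singleton]
    exact pow_dvd_pow _ (Nat.le_succ a)
  let π : (R ⧸ Ideal.span {T ^ (a + 1)}) →ₗ[k] R ⧸ Ideal.span {T ^ a} :=
    (Ideal.Quotient.factorₐ k hle).toLinearMap
  have hcomap : Ideal.span {T} ≤
      Submodule.comap (LinearMap.mulLeft R (T ^ a)) (Ideal.span {T ^ (a + 1)}) := by
    rw [Ideal.span, Submodule.span_le, Set.singleton_subset_iff]
    change T ^ a * T ∈ Ideal.span {T ^ (a + 1)}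
    rw [← pow_succ]
    exact Ideal.mem_span_singleton_self _
  let μ : (R ⧸ Ideal.span {T}) →ₗ[k] R ⧸ Ideal.span {T ^ (a + 1)} :=
    (Submodule.mapQ _ _ _ hcomap).restrictScalars k
  have hker : LinearMap.ker π ≤ LinearMap.range μ := by
    intro x hx
    obtain ⟨r, rfl⟩ := Ideal.Quotient.mk_surjective x
    have hr : r ∈ Ideal.span {T ^ a} := Ideal.Quotient.eq_zero_iff_mem.mp hx
    obtain ⟨s, rfl⟩ := Ideal.mem_span_singleton'.mp hr
    refine ⟨Ideal.Quotient.mk _ s, ?_⟩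
    rw [mul_comm s]
    rfl
  rw [← π.finrank_range_add_finrank_ker]
  exact add_le_add (Submodule.finrank_le _)
    ((Submodule.finrank_mono hker).trans (LinearMap.finrank_range_le μ))

theorem boxDim_mono (n : ℕ) {q : ℕ} (hq : 0 < q) (a : ℕ) :
    boxDim k n q a ≤ boxDim k n q (a + 1) := by
  have := (finrank_boxRing k n hq).1
  have hle : Ideal.span {boxSumSq k n q ^ (a + 1)} ≤ Ideal.span {boxSumSq k n q ^ a} := by
    rw [Ideal.span_singleton_le_span_singleton]
    exact pow_dvd_pow _ (Nat.le_succ a)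
  exact LinearMap.finrank_le_finrank_of_surjective
    (f := (Ideal.Quotient.factorₐ k hle).toLinearMap) (Ideal.Quotient.factor_surjective hle)

/-- Dropping X^q leaves the quotient by X² + T, monic of degree 2 over a ring of dimension q^n. This
is the source of the Lipschitz constant 2. -/
theorem boxDim_one_le (n : ℕ) {q : ℕ} (hq : 0 < q) : boxDim k (n + 1) q 1 ≤ 2 * q ^ n := by
  obtain ⟨hfin, hrank⟩ := finrank_boxRing k n hq
  have := nontrivial_boxRing k n hq
  have hm : (Polynomial.X ^ 2 + Polynomial.C (boxSumSq k n q)).Monic :=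
    Polynomial.monic_X_pow_add_C _ two_ne_zero
  have hle : Ideal.span {Polynomial.X ^ 2 + Polynomial.C (boxSumSq k n q)} ≤ Ideal.span
      {Polynomial.X ^ q, (Polynomial.X ^ 2 + Polynomial.C (boxSumSq k n q)) ^ 1} := by
    rw [pow_one]
    exact Ideal.span_mono (by simp)
  have := module_finite_quotient_of_pow_mem k hm (Ideal.mem_span_singleton_self _)
  have h := LinearMap.finrank_le_finrank_of_surjective
    (f := (Ideal.Quotient.factorₐ k hle).toLinearMap) (Ideal.Quotient.factor_surjective hle)
  rw [finrank_quotient_span_monic k hm, hrank, Polynomial.natDegree_X_pow_add_C] at h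
  rw [boxDim_succ]
  exact h

theorem boxDim_succ_le (n : ℕ) {q : ℕ} (hq : 0 < q) (a : ℕ) :
    boxDim k (n + 1) q (a + 1) ≤ boxDim k (n + 1) q a + 2 * q ^ n := by
  have := (finrank_boxRing k (n + 1) hq).1
  have h1 := finrank_quotient_span_pow_succ_le k (boxSumSq k (n + 1) q) a
  have h2 := boxDim_one_le k n hq
  rw [boxDim, pow_one] at h2
  exact h1.trans (add_le_add_right h2 _)

theorem abs_boxDim_sub_le (n : ℕ) {q : ℕ} (hq : 0 < q) (a b : ℕ) :
    |(boxDim k (n + 1) q a : ℝ) - boxDim k (n + 1) q b| ≤ 2 * q ^ n * |(a : ℝ) - b| := by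
  have key : ∀ a j : ℕ, boxDim k (n + 1) q a ≤ boxDim k (n + 1) q (a + j) ∧
      boxDim k (n + 1) q (a + j) ≤ boxDim k (n + 1) q a + 2 * q ^ n * j := by
    intro a j
    induction j with
    | zero => simp
    | succ j ih =>
      refine ⟨ih.1.trans (boxDim_mono k _ hq _), (boxDim_succ_le k n hq _).trans ?_⟩
      rw [mul_add, mul_one, ← add_assoc]
      exact Nat.add_le_add_right ih.2 _
  have key' : ∀ a b : ℕ, a ≤ b →
      |(boxDim k (n + 1) q a : ℝ) - boxDim k (n + 1) q b| ≤ 2 * q ^ n * |(a : ℝ) - b| := by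
    intro a b hab
    obtain ⟨j, rfl⟩ := Nat.exists_eq_add_of_le hab
    obtain ⟨h1, h2⟩ := key a j
    have h1' : (boxDim k (n + 1) q a : ℝ) ≤ boxDim k (n + 1) q (a + j) := by exact_mod_cast h1
    have h2' : (boxDim k (n + 1) q (a + j) : ℝ) ≤ boxDim k (n + 1) q a + 2 * q ^ n * j := by
      exact_mod_cast h2
    rw [abs_sub_comm, abs_of_nonneg (by linarith), abs_sub_comm (a : ℝ)]
    push_cast
    rw [add_sub_cancel_left, abs_of_nonneg (Nat.cast_nonneg j)]
    linarith
  rcases le_total a b with h | h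
  · exact key' a b h
  · rw [abs_sub_comm, abs_sub_comm (a : ℝ)]
    exact key' b a h

end BoxDimBounds

/-! ### Existence and uniqueness of the functions for fixed p -/

section Phi

theorem phiValue_fermatQuadric (n p : ℕ) [Fact p.Prime] (e a : ℕ) :
    phiValue (fermatQuadric n p) e a = boxDim (ZMod p) n (p ^ e) a / (p : ℝ) ^ (n * e) := by
  have h := finrank_mvPowerSeries_quotient_span_X_pow_union (k := ZMod p) (σ := Fin n) (p ^ e)
    {sumSq (ZMod p) n ^ a}
  have hc : ((sumSq (ZMod p) n ^ a : MvPolynomial (Fin n) (ZMod p)) :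
      MvPowerSeries (Fin n) (ZMod p)) = fermatQuadric n p ^ a := by
    rw [MvPolynomial.coe_pow, sumSq, fermatQuadric]
    congr 1
    have := map_sum (MvPolynomial.coeToMvPowerSeries.ringHom (σ := Fin n) (R := ZMod p))
      (fun i => (MvPolynomial.X i : MvPolynomial (Fin n) (ZMod p)) ^ 2) Finset.univ
    simp only [MvPolynomial.coeToMvPowerSeries.ringHom_apply, MvPolynomial.coe_pow,
      MvPolynomial.coe_X] at this
    exact this
  rw [Set.image_singleton, hc, ← boxDim_eq_finrank] at h
  rw [phiValue, phiIdeal, h]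

theorem phiValue_add_exponent (n p : ℕ) [Fact p.Prime] (e j a : ℕ) :
    phiValue (fermatQuadric n p) (e + j) (p ^ j * a) = phiValue (fermatQuadric n p) e a := by
  have hp : 0 < p := (Fact.out : p.Prime).pos
  induction j with
  | zero => simp
  | succ j ih =>
    rw [← ih, phiValue_fermatQuadric, phiValue_fermatQuadric, ← add_assoc, pow_succ' p (e + j),
      pow_succ' p j, mul_assoc, boxDim_mul_prime p n (pow_pos hp _)]
    have : (p : ℝ) ≠ 0 := by exact_mod_cast hp.ne'
    push_cast
    rw [mul_add n (e + j), mul_one, pow_add (p : ℝ) (n * (e + j)) n, mul_comm ((p : ℝ) ^ n)]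
    exact mul_div_mul_right _ _ (pow_ne_zero n this)

theorem abs_phiValue_sub_le (n p : ℕ) [Fact p.Prime] (hn : 1 ≤ n) (e e' a b : ℕ) :
    |phiValue (fermatQuadric n p) e a - phiValue (fermatQuadric n p) e' b| ≤
      2 * |(a : ℝ) / p ^ e - b / p ^ e'| := by
  obtain ⟨n, rfl⟩ := Nat.exists_eq_add_of_le' hn
  have hp : 0 < p := (Fact.out : p.Prime).pos
  have hp' : (0 : ℝ) < p := by exact_mod_cast hp
  have h := abs_boxDim_sub_le (ZMod p) n (pow_pos hp (e + e')) (p ^ e' * a) (p ^ e * b)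
  rw [← phiValue_add_exponent (n + 1) p e e' a, ← phiValue_add_exponent (n + 1) p e' e b,
    add_comm e' e, phiValue_fermatQuadric, phiValue_fermatQuadric, ← sub_div, abs_div,
    abs_of_pos (pow_pos hp' ((n + 1) * (e + e'))), div_le_iff₀ (pow_pos hp' _)]
  refine h.trans (le_of_eq ?_)
  have h2 : (a : ℝ) / p ^ e - b / p ^ e' = (p ^ e' * a - p ^ e * b) / p ^ (e + e') := by
    rw [pow_add]
    field_simp
  rw [h2, abs_div, abs_of_pos (pow_pos hp' (e + e')), add_mul n 1 (e + e'), one_mul,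
    pow_add _ (n * (e + e')), mul_comm n, pow_mul (p : ℝ) (e + e') n]
  push_cast
  field_simp

theorem exists_lipschitz_phi (n p : ℕ) [Fact p.Prime] (hn : 1 ≤ n) :
    ∃ Φ : ℝ → ℝ, LipschitzWith 2 Φ ∧
      ∀ e a : ℕ, Φ ((a : ℝ) / (p : ℝ) ^ e) = phiValue (fermatQuadric n p) e a := by
  let ι : ℕ × ℕ → ℝ := fun x => (x.2 : ℝ) / (p : ℝ) ^ x.1
  let v : ℕ × ℕ → ℝ := fun x => phiValue (fermatQuadric n p) x.1 x.2
  have hv : ∀ x y, |v x - v y| ≤ 2 * |ι x - ι y| := fun x y =>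
    abs_phiValue_sub_le n p hn x.1 y.1 x.2 y.2
  -- The chosen representation a/p^e is immaterial: by `hv`, equal points carry equal values.
  let F : ℝ → ℝ := fun t => v (Function.invFun ι t)
  have hF : ∀ x, F (ι x) = v x := by
    intro x
    have h1 : ι (Function.invFun ι (ι x)) = ι x := Function.invFun_eq ⟨x, rfl⟩
    have h2 := hv (Function.invFun ι (ι x)) x
    rw [h1, sub_self, abs_zero, mul_zero] at h2
    exact sub_eq_zero.mp (abs_nonpos_iff.mp h2)
  have hlip : LipschitzOnWith 2 F (Set.range ι) := by
    refine LipschitzOnWith.of_dist_le_mul ?_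
    rintro _ ⟨x, rfl⟩ _ ⟨y, rfl⟩
    rw [hF, hF, Real.dist_eq, Real.dist_eq]
    exact hv x y
  obtain ⟨Φ, hΦ, heq⟩ := hlip.extend_real
  exact ⟨Φ, hΦ, fun e a => (heq ⟨(e, a), rfl⟩).symm.trans (hF (e, a))⟩

theorem IsPhi.eqOn {n p : ℕ} (hp : p.Prime) {f : MvPowerSeries (Fin n) (ZMod p)} {Φ Ψ : ℝ → ℝ}
    (hΦ : IsPhi f Φ) (hΨ : IsPhi f Ψ) : Set.EqOn Φ Ψ (Set.Icc 0 1) := by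
  intro t ht
  have hp' : (1 : ℝ) < p := by exact_mod_cast hp.one_lt
  -- The points ⌊t p^e⌋ / p^e approximate t from within [0, 1], and both functions have the
  -- prescribed values there.
  let a : ℕ → ℕ := fun e => ⌊t * (p : ℝ) ^ e⌋₊
  let u : ℕ → ℝ := fun e => (a e : ℝ) / (p : ℝ) ^ e
  have hu : Tendsto u atTop (𝓝 t) :=
    (tendsto_nat_floor_mul_div_atTop ht.1).comp (tendsto_pow_atTop_atTop_of_one_lt hp')
  have ha : ∀ e, a e ≤ p ^ e := by
    intro e
    apply Nat.floor_le_of_le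
    push_cast
    exact mul_le_of_le_one_left (by positivity) ht.2
  have hmem : ∀ e, u e ∈ Set.Icc (0 : ℝ) 1 := by
    intro e
    refine ⟨by positivity, (div_le_one (by positivity)).mpr ?_⟩
    exact_mod_cast ha e
  have hu' : Tendsto u atTop (𝓝[Set.Icc 0 1] t) :=
    tendsto_nhdsWithin_iff.mpr ⟨hu, Eventually.of_forall hmem⟩
  refine tendsto_nhds_unique ((hΦ.continuousOn t ht).tendsto.comp hu') ?_
  refine ((hΨ.continuousOn t ht).tendsto.comp hu').congr fun e => ?_
  simp only [Function.comp_apply]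
  exact (hΨ.apply_div e _ (ha e)).trans (hΦ.apply_div e _ (ha e)).symm

end Phi

end

noncomputable section

/-! ### Iterated averages of the triangle wave -/

section LimitWave

open intervalIntegral

/-- The triangle wave of period `2` which is the identity on `[-1/2, 1/2]`. -/
def triangleWave (t : ℝ) : ℝ := Real.arcsin (Real.sin (Real.pi * t)) / Real.pi

theorem continuous_triangleWave : Continuous triangleWave := by
  unfold triangleWave
  exact (Real.continuous_arcsin.comp (by fun_prop)).div_const _

theorem antiperiodic_triangleWave : Function.Antiperiodic triangleWave 1 := by
  intro t
  rw [triangleWave, triangleWave, mul_add, mul_one, Real.sin_add_pi, Real.arcsin_neg, neg_div]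

theorem triangleWave_neg (t : ℝ) : triangleWave (-t) = -triangleWave t := by
  rw [triangleWave, triangleWave, mul_neg, Real.sin_neg, Real.arcsin_neg, neg_div]

theorem triangleWave_eq_self {t : ℝ} (h0 : -(1 / 2) ≤ t) (h1 : t ≤ 1 / 2) : triangleWave t = t := by
  have hpi := Real.pi_pos
  rw [triangleWave, Real.arcsin_sin (by nlinarith) (by nlinarith)]
  field_simp

theorem triangleWave_eq_one_sub {t : ℝ} (h0 : 1 / 2 ≤ t) (h1 : t ≤ 3 / 2) :
    triangleWave t = 1 - t := by
  have h := antiperiodic_triangleWave (t - 1)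
  rw [sub_add_cancel, triangleWave_eq_self (t := t - 1) (by linarith) (by linarith)] at h
  rw [h]
  ring

/-- Iterated averages of the triangle wave over intervals of length one. -/
def limitWave : ℕ → ℝ → ℝ
  | 0, t => triangleWave t
  | m + 1, t => ∫ s in (t - 1 / 2)..(t + 1 / 2), limitWave m s

theorem hasDerivAt_integral_window {g : ℝ → ℝ} (hg : Continuous g) (t : ℝ) :
    HasDerivAt (fun x => ∫ s in (x - 1 / 2)..(x + 1 / 2), g s) (g (t + 1 / 2) - g (t - 1 / 2)) t := by
  have h0 : ∀ x, HasDerivAt (fun x => ∫ s in (0 : ℝ)..x, g s) (g x) x := fun x =>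
    (hg.integral_hasStrictDerivAt 0 x).hasDerivAt
  have h1 := (h0 (t + 1 / 2)).comp_add_const t (1 / 2)
  have h2 := (h0 (t - 1 / 2)).comp_sub_const t (1 / 2)
  refine (h1.sub h2).congr_of_eventuallyEq (Eventually.of_forall fun x => ?_)
  exact (integral_interval_sub_left (hg.intervalIntegrable _ _) (hg.intervalIntegrable _ _)).symm

theorem continuous_limitWave (m : ℕ) : Continuous (limitWave m) := by
  induction m with
  | zero => exact continuous_triangleWave
  | succ m ih =>
    exact continuous_iff_continuousAt.mpr fun t => (hasDerivAt_integral_window ih t).continuousAt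

theorem antiperiodic_limitWave (m : ℕ) : Function.Antiperiodic (limitWave m) 1 := by
  induction m with
  | zero => exact antiperiodic_triangleWave
  | succ m ih =>
    intro t
    rw [limitWave, limitWave, ← integral_neg]
    have := integral_comp_add_right (limitWave m) (1 : ℝ) (a := t - 1 / 2) (b := t + 1 / 2)
    rw [show t + 1 - 1 / 2 = t - 1 / 2 + 1 by ring, show t + 1 + 1 / 2 = t + 1 / 2 + 1 by ring,
      ← this]
    exact integral_congr fun s _ => ih s

/-- The derivative is the difference of the values at the window's ends, which are 1 apart and hence
negatives of each other. -/
theorem hasDerivAt_limitWave_succ (m : ℕ) (t : ℝ) :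
    HasDerivAt (limitWave (m + 1)) (-2 * limitWave m (t - 1 / 2)) t := by
  have h := hasDerivAt_integral_window (continuous_limitWave m) t
  have h2 := antiperiodic_limitWave m (t - 1 / 2)
  rw [show t - 1 / 2 + 1 = t + 1 / 2 by ring] at h2
  rw [h2, show -limitWave m (t - 1 / 2) - limitWave m (t - 1 / 2) = -2 * limitWave m (t - 1 / 2) by
    ring] at h
  exact h

theorem limitWave_add_nat (m : ℕ) (t : ℝ) (j : ℕ) :
    limitWave m (t + j) = (-1) ^ j * limitWave m t := by
  induction j with
  | zero => simp
  | succ j ih =>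
    push_cast
    rw [← add_assoc, antiperiodic_limitWave, ih]
    ring

/-- The function descends to a circle, which is compact. -/
theorem Function.Periodic.uniformContinuous_of_continuous {g : ℝ → ℝ} {T : ℝ} (hT : 0 < T)
    (hg : Function.Periodic g T) (hc : Continuous g) : UniformContinuous g := by
  have : Fact (0 < T) := ⟨hT⟩
  have h1 : Continuous (hg.lift : AddCircle T → ℝ) := by
    rw [(QuotientAddGroup.isQuotientMap_mk (N := AddSubgroup.zmultiples T)).continuous_iff]
    exact hc
  have h2 : UniformContinuous ((↑) : ℝ → AddCircle T) :=
    uniformContinuous_of_continuousAt_zero (QuotientAddGroup.mk' (AddSubgroup.zmultiples T))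
      (AddCircle.continuous_mk' T).continuousAt
  exact (CompactSpace.uniformContinuous_of_continuous h1).comp h2

theorem uniformContinuous_limitWave (m : ℕ) : UniformContinuous (limitWave m) :=
  (antiperiodic_limitWave m).periodic_two_mul.uniformContinuous_of_continuous (by norm_num)
    (continuous_limitWave m)

end LimitWave

/-! ### Riemann sums over a unit window, uniformly in its centre -/

section RiemannSum

theorem exists_riemann_sum_window {g : ℝ → ℝ} (hg : UniformContinuous g) {ε : ℝ} (hε : 0 < ε) :
    ∃ P : ℕ, ∀ p : ℕ, P ≤ p → Odd p → ∀ b : ℤ,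
      |(∑ j ∈ Finset.range p, g (((b + (p / 2 : ℕ) - j : ℤ) : ℝ) / p)) / p -
        ∫ s in ((b : ℝ) / p - 1 / 2)..((b : ℝ) / p + 1 / 2), g s| ≤ ε := by
  obtain ⟨δ, hδ, hgδ⟩ := Metric.uniformContinuous_iff.mp hg ε hε
  obtain ⟨P, hP⟩ := exists_nat_one_div_lt hδ
  refine ⟨P + 1, fun p hPp hodd b => ?_⟩
  obtain ⟨h, hh⟩ := hodd
  have hp : (0 : ℝ) < p := by exact_mod_cast (by omega : 0 < p)
  have hpδ : 1 / (p : ℝ) < δ := by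
    refine lt_of_le_of_lt ?_ hP
    apply one_div_le_one_div_of_le (by positivity)
    exact_mod_cast hPp
  have hph : (p : ℝ) = 2 * h + 1 := by exact_mod_cast hh
  -- The shift by 1/2 puts the sample points at the midpoints of the cells. As p = 2h + 1, the p
  -- cells fill the unit window exactly.
  let x : ℕ → ℝ := fun j => ((b : ℝ) - h + j - 1 / 2) / p
  have hx0 : x 0 = (b : ℝ) / p - 1 / 2 := by
    simp only [x]
    field_simp
    rw [hph]
    push_cast
    ring
  have hxp : x p = (b : ℝ) / p + 1 / 2 := by
    simp only [x]
    field_simp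
    rw [hph]
    ring
  have hint := intervalIntegral.sum_integral_adjacent_intervals (f := g) (a := x) (n := p)
    (μ := MeasureTheory.volume) fun j _ => hg.continuous.intervalIntegrable _ _
  have hlen : ∀ j, x (j + 1) - x j = 1 / p := by
    intro j
    simp only [x]
    push_cast
    ring
  have hterm : ∀ j : ℕ, |g (((b - h + j : ℤ) : ℝ) / p) / p - ∫ s in x j..x (j + 1), g s| ≤ ε / p := by
    intro j
    have hmid : ((b - h + j : ℤ) : ℝ) / p = x j + 1 / 2 * (1 / p) := by
      simp only [x]
      push_cast
      ring
    set c := ((b - h + j : ℤ) : ℝ) / p with hc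
    have h1 : g c / p = ∫ s in x j..x (j + 1), g c := by
      rw [intervalIntegral.integral_const, hlen, smul_eq_mul]
      ring
    have hpos : 0 < 1 / (p : ℝ) := by positivity
    rw [h1, ← intervalIntegral.integral_sub (by simp) (hg.continuous.intervalIntegrable _ _)]
    have h2 := intervalIntegral.norm_integral_le_of_norm_le_const (a := x j) (b := x (j + 1))
      (f := fun s => g c - g s) (C := ε) (fun s hs => by
        rw [Set.uIoc_of_le (by linarith [hlen j])] at hs
        rw [← dist_eq_norm]
        refine (hgδ ?_).le
        rw [Real.dist_eq, abs_lt]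
        have := hlen j
        constructor <;> linarith [hs.1, hs.2])
    rw [hlen, abs_of_pos hpos] at h2
    rw [← Real.norm_eq_abs]
    exact h2.trans (le_of_eq (by ring))
  have hsum : ∑ j ∈ Finset.range p, g (((b + (p / 2 : ℕ) - j : ℤ) : ℝ) / p) =
      ∑ j ∈ Finset.range p, g (((b - h + j : ℤ) : ℝ) / p) := by
    rw [← Finset.sum_range_reflect]
    refine Finset.sum_congr rfl fun j hj => ?_
    rw [Finset.mem_range] at hj
    congr 3
    omega
  rw [hsum, ← hx0, ← hxp, ← hint, Finset.sum_div, ← Finset.sum_sub_distrib]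
  refine (Finset.abs_sum_le_sum_abs _ _).trans ((Finset.sum_le_sum fun j _ => hterm j).trans ?_)
  rw [Finset.sum_const, Finset.card_range, nsmul_eq_mul]
  exact le_of_eq (by field_simp)

end RiemannSum

/-! ### Asymptotics of the window sums -/

section BoxSeqAsymptotics

/-- Moving the window one place to the right gains a value 1 and drops a value -1. -/
theorem boxSeq_one_of_le {p h : ℕ} (hp : p = 2 * h + 1) {b : ℕ} (hb : b ≤ h) :
    boxSeq p 1 b = 2 * b := by
  have hodd : Odd p := ⟨h, hp⟩
  induction b with
  | zero => simpa using boxSeq_apply_zero hodd 1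
  | succ b ih =>
    have h1 := Finset.sum_range_succ (fun j : ℕ => boxSeq p 0 ((b + 1 : ℕ) + (p / 2 : ℕ) - j)) p
    rw [Finset.sum_range_succ'] at h1
    have h2 : ∑ j ∈ Finset.range p, boxSeq p 0 ((b + 1 : ℕ) + (p / 2 : ℕ) - (j + 1 : ℕ)) =
        boxSeq p 1 b := by
      rw [boxSeq]
      refine Finset.sum_congr rfl fun j _ => ?_
      congr 1
      push_cast
      ring
    have h3 : boxSeq p 0 ((b + 1 : ℕ) + (p / 2 : ℕ) - (0 : ℕ)) = 1 :=
      boxSeq_zero_of_pos (by omega) (by omega)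
    have h4 : boxSeq p 0 ((b + 1 : ℕ) + (p / 2 : ℕ) - p) = -1 := by
      rw [← neg_neg (((b + 1 : ℕ) : ℤ) + (p / 2 : ℕ) - p), boxSeq_neg hodd,
        boxSeq_zero_of_pos (by omega) (by omega)]
    rw [h2, h3, h4, ih (by omega)] at h1
    rw [boxSeq]
    push_cast at h1 ⊢
    linarith

theorem boxSeq_one_of_lt {p h : ℕ} (hp : p = 2 * h + 1) {b : ℕ} (hb : h < b) (hbp : b ≤ p) :
    boxSeq p 1 b = p := by
  rw [boxSeq, Finset.sum_congr rfl fun j hj => boxSeq_zero_of_pos (p := p) ?_ ?_]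
  · simp
  all_goals
    rw [Finset.mem_range] at hj
    omega

/-- As functions of b, both sides are odd with period 2p, so comparing them for 0 ≤ b ≤ p suffices.
-/
theorem boxSeq_one_sub_div (p : ℕ) (hp : Odd p) (b : ℤ) :
    ((boxSeq p 1 b : ℝ) - b) / p = triangleWave ((b : ℝ) / p) := by
  have hp0 : (0 : ℝ) < p := by exact_mod_cast hp.pos
  let d : ℤ → ℝ := fun b => ((boxSeq p 1 b : ℝ) - b) / p - triangleWave ((b : ℝ) / p)
  have hper : Function.Periodic d (2 * p : ℤ) := by
    intro b
    have h1 : ((b + 2 * p : ℤ) : ℝ) / p = (b : ℝ) / p + 2 * 1 := by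
      push_cast
      field_simp
    simp only [d]
    rw [h1, antiperiodic_triangleWave.periodic_two_mul, boxSeq_add_two_mul hp.pos]
    push_cast
    ring
  have hodd : ∀ b, d (-b) = -d b := by
    intro b
    simp only [d]
    rw [boxSeq_neg hp, Int.cast_neg, Int.cast_neg, neg_div (p : ℝ) (b : ℝ), triangleWave_neg]
    ring
  have hnat : ∀ b : ℕ, b ≤ p → d b = 0 := by
    intro b hb
    obtain ⟨h, hh⟩ := hp
    have hph : (p : ℝ) = 2 * h + 1 := by exact_mod_cast hh
    simp only [d]
    rw [sub_eq_zero]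
    rcases le_or_gt b h with hbh | hbh
    · have hbh' : (b : ℝ) ≤ h := by exact_mod_cast hbh
      rw [boxSeq_one_of_le hh hbh, triangleWave_eq_self]
      · push_cast
        ring
      · exact le_trans (by norm_num) (div_nonneg (by simp) hp0.le)
      · rw [div_le_iff₀ hp0]
        push_cast
        linarith
    · have hbh' : (h : ℝ) + 1 ≤ b := by exact_mod_cast hbh
      have hb' : (b : ℝ) ≤ p := by exact_mod_cast hb
      rw [boxSeq_one_of_lt hh hbh hb, triangleWave_eq_one_sub]
      · push_cast
        field_simp
      · rw [le_div_iff₀ hp0]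
        push_cast
        linarith
      · rw [div_le_iff₀ hp0]
        push_cast
        linarith
  suffices hd : d b = 0 from sub_eq_zero.mp hd
  have hpz : (0 : ℤ) < 2 * p := by
    have := hp.pos
    omega
  have hmod : d (b % (2 * p : ℤ)) = d b := by
    have h := hper.int_mul (b / (2 * p : ℤ)) (b % (2 * p : ℤ))
    rw [← h]
    congr 1
    have := Int.emod_add_mul_ediv b (2 * p : ℤ)
    rw [Int.cast_id]
    linarith
  rw [← hmod]
  have h0 := Int.emod_nonneg b hpz.ne'
  have h1 := Int.emod_lt_of_pos b hpz
  set r := b % (2 * p : ℤ)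
  rcases le_or_gt r p with hr | hr
  · obtain ⟨s, hs⟩ := Int.eq_ofNat_of_zero_le h0
    rw [hs]
    exact hnat s (by omega)
  · have h2 : d r = -d (2 * p - r) := by
      rw [← hodd, ← hper (-(2 * p - r))]
      congr 1
      ring
    rw [h2]
    obtain ⟨s, hs⟩ := Int.eq_ofNat_of_zero_le (by omega : 0 ≤ 2 * (p : ℤ) - r)
    rw [hs, hnat s (by omega), neg_zero]

/-- The normalized deviation of `boxSeq` from its linear part. -/
def boxDeviation (p m : ℕ) (b : ℤ) : ℝ := ((boxSeq p (m + 1) b : ℝ) - b * p ^ m) / p ^ (m + 1)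

/-- For odd p the window is symmetric about b, so averaging preserves the linear part and acts on
the deviation alone. -/
theorem boxDeviation_succ {p : ℕ} (hp : Odd p) (m : ℕ) (b : ℤ) :
    boxDeviation p (m + 1) b =
      (∑ j ∈ Finset.range p, boxDeviation p m (b + (p / 2 : ℕ) - j)) / p := by
  have hp0 : (p : ℝ) ≠ 0 := by exact_mod_cast hp.pos.ne'
  obtain ⟨h, hh⟩ := hp
  have h1 : ∑ j ∈ Finset.range p, ((b + (p / 2 : ℕ) - j : ℤ) : ℝ) = p * b := by
    have h2 : ∑ j ∈ Finset.range p, ((b + (p / 2 : ℕ) - j : ℤ) : ℝ) =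
        ∑ j ∈ Finset.range p, ((b - (p / 2 : ℕ) + j : ℤ) : ℝ) := by
      rw [← Finset.sum_range_reflect]
      refine Finset.sum_congr rfl fun j hj => ?_
      rw [Finset.mem_range] at hj
      congr 1
      omega
    have h3 : ∑ j ∈ Finset.range p, ((b + (p / 2 : ℕ) - j : ℤ) : ℝ) +
        ∑ j ∈ Finset.range p, ((b + (p / 2 : ℕ) - j : ℤ) : ℝ) = 2 * (p * b) := by
      nth_rewrite 2 [h2]
      rw [← Finset.sum_add_distrib]
      push_cast
      ring_nf
      simp
      ring
    linarith
  have h4 : (boxSeq p (m + 1 + 1) b : ℝ) =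
      ∑ j ∈ Finset.range p, (boxSeq p (m + 1) (b + (p / 2 : ℕ) - j) : ℝ) := by
    rw [boxSeq]
    push_cast
    rfl
  simp only [boxDeviation]
  rw [← Finset.sum_div, Finset.sum_sub_distrib, ← Finset.sum_mul, h1, h4, div_div, pow_succ _ (m + 1)]
  congr 1
  rw [pow_succ]
  ring

theorem exists_abs_boxDeviation_sub_limitWave_le (m : ℕ) {ε : ℝ} (hε : 0 < ε) :
    ∃ P : ℕ, ∀ p : ℕ, P ≤ p → Odd p → ∀ b : ℤ,
      |boxDeviation p m b - limitWave m ((b : ℝ) / p)| ≤ ε := by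
  induction m generalizing ε with
  | zero =>
    refine ⟨0, fun p _ hp b => ?_⟩
    have h := boxSeq_one_sub_div p hp b
    rw [boxDeviation, limitWave, ← h]
    simpa using hε.le
  | succ m ih =>
    obtain ⟨P₁, hP₁⟩ := ih (half_pos hε)
    obtain ⟨P₂, hP₂⟩ := exists_riemann_sum_window (uniformContinuous_limitWave m) (half_pos hε)
    refine ⟨max P₁ P₂, fun p hPp hp b => ?_⟩
    have hp0 : (0 : ℝ) < p := by exact_mod_cast hp.pos
    have h2 := hP₂ p (le_of_max_le_right hPp) hp b
    have h1 : |boxDeviation p (m + 1) b -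
        (∑ j ∈ Finset.range p, limitWave m (((b + (p / 2 : ℕ) - j : ℤ) : ℝ) / p)) / p| ≤ ε / 2 := by
      rw [boxDeviation_succ hp, ← sub_div, ← Finset.sum_sub_distrib, abs_div, abs_of_pos hp0,
        div_le_iff₀ hp0]
      refine (Finset.abs_sum_le_sum_abs _ _).trans
        ((Finset.sum_le_sum fun j _ => hP₁ p (le_of_max_le_left hPp) hp _).trans ?_)
      rw [Finset.sum_const, Finset.card_range, nsmul_eq_mul, mul_comm]
    rw [limitWave]
    exact (abs_sub_le _ _ _).trans ((add_le_add h1 h2).trans (add_halves ε).le)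

end BoxSeqAsymptotics

/-! ### Uniform convergence as p tends to infinity -/

section Convergence

theorem tendstoUniformlyOn_of_isPhi (m : ℕ) {Φ : ℕ → ℝ → ℝ}
    (hΦ : ∀ p : ℕ, p.Prime → IsPhi (fermatQuadric (m + 1) p) (Φ p)) :
    TendstoUniformlyOn Φ (fun t => t + limitWave m t) (atTop ⊓ 𝓟 {p : ℕ | p.Prime})
      (Set.Icc 0 1) := by
  rw [Metric.tendstoUniformlyOn_iff]
  intro ε hε
  obtain ⟨P₁, hP₁⟩ := exists_abs_boxDeviation_sub_limitWave_le m (show 0 < ε / 4 by positivity)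
  obtain ⟨δ, hδ, hgδ⟩ :=
    Metric.uniformContinuous_iff.mp (uniformContinuous_limitWave m) (ε / 4) (by positivity)
  -- Replacing t by a nearby a/p costs 1/p in the linear term and 2/p by the Lipschitz bound. With
  -- 1/p < ε/12 this totals less than ε/4.
  obtain ⟨P₂, hP₂⟩ := exists_nat_one_div_lt (show 0 < min δ (ε / 12) by positivity)
  rw [eventually_inf_principal]
  filter_upwards [eventually_ge_atTop P₁, eventually_ge_atTop (P₂ + 1), eventually_ge_atTop 3]
    with p hp₁ hp₂ hp₃ hprime t ht
  have hprime : p.Prime := hprime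
  have : Fact p.Prime := ⟨hprime⟩
  have hodd : Odd p := hprime.odd_of_ne_two (by omega)
  have hp0 : (0 : ℝ) < p := by exact_mod_cast hprime.pos
  have hpsmall : 1 / (p : ℝ) < min δ (ε / 12) := by
    refine lt_of_le_of_lt ?_ hP₂
    apply one_div_le_one_div_of_le (by positivity)
    exact_mod_cast hp₂
  obtain ⟨Ψ, hlip, hval⟩ := exists_lipschitz_phi (m + 1) p (by omega)
  have hΨ : IsPhi (fermatQuadric (m + 1) p) Ψ := ⟨hlip.continuous.continuousOn, fun e a _ => hval e a⟩
  rw [(hΦ p hprime).eqOn hprime hΨ ht]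
  set a := ⌊t * p⌋₊ with ha
  have ha1 : (a : ℝ) ≤ t * p := Nat.floor_le (mul_nonneg ht.1 hp0.le)
  have ha2 : t * p < a + 1 := Nat.lt_floor_add_one _
  have hap : a ≤ p := by
    have : (a : ℝ) ≤ p := ha1.trans (mul_le_of_le_one_left hp0.le ht.2)
    exact_mod_cast this
  have hdist : |t - a / p| ≤ 1 / p := by
    have h1 : (a : ℝ) / p ≤ t := by rwa [div_le_iff₀ hp0]
    have h2 : t - a / p ≤ 1 / p := by
      rw [sub_le_iff_le_add, ← add_div, le_div_iff₀ hp0]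
      linarith
    rwa [abs_of_nonneg (by linarith)]
  have h1 : |Ψ t - Ψ (a / p)| ≤ 2 * (1 / p) := by
    have := hlip.dist_le_mul t (a / p)
    rw [Real.dist_eq, Real.dist_eq] at this
    exact this.trans (mul_le_mul_of_nonneg_left hdist (by norm_num))
  have h2 : Ψ (a / p) = a / p + boxDeviation p m a := by
    have h3 := hval 1 a
    have h4 := boxDim_eq_boxSeq (ZMod p) p hodd (m + 1) hap
    rw [phiValue_fermatQuadric, pow_one, pow_one, mul_one] at h3
    have h5 : (boxDim (ZMod p) (m + 1) p a : ℝ) = boxSeq p (m + 1) a := by exact_mod_cast h4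
    rw [h3, h5, boxDeviation, pow_succ]
    push_cast
    field_simp
    ring
  have h3 := hP₁ p hp₁ hodd a
  rw [Int.cast_natCast] at h3
  have h4 : |limitWave m t - limitWave m (a / p)| < ε / 4 := by
    have := hgδ (a := t) (b := a / p)
      (by rw [Real.dist_eq]; exact hdist.trans_lt (hpsmall.trans_le (min_le_left _ _)))
    rwa [Real.dist_eq] at this
  have h5 : 1 / (p : ℝ) < ε / 12 := hpsmall.trans_le (min_le_right _ _)
  rw [Real.dist_eq]
  rw [h2] at h1
  rw [abs_le] at h1 h3 hdist
  rw [abs_lt] at h4 ⊢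
  constructor <;> linarith [h1.1, h1.2, h3.1, h3.2, hdist.1, hdist.2, h4.1, h4.2]

end Convergence

end

noncomputable section

/-! ### Euler polynomials -/

section EulerPolynomial

open Polynomial

/-- The coefficients of the power series `1 / (e^x + 1)`. -/
def eulerCoeff (j : ℕ) : ℚ := PowerSeries.coeff j (PowerSeries.exp ℚ + 1)⁻¹

theorem eulerPolynomial_eq_sum (n : ℕ) :
    eulerPolynomial n = C (2 * (n.factorial : ℚ)) *
      ∑ i ∈ Finset.range (n + 1), C ((i.factorial : ℚ)⁻¹ * eulerCoeff (n - i)) * X ^ i := by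
  have h2 : (2 : PowerSeries ℚ[X]) = PowerSeries.C (2 : ℚ[X]) :=
    (map_ofNat PowerSeries.C 2).symm
  rw [eulerPolynomial, eulerGenFun, h2, mul_assoc, PowerSeries.coeff_C_mul, PowerSeries.coeff_mul,
    Finset.Nat.sum_antidiagonal_eq_sum_range_succ_mk, Finset.mul_sum, Finset.mul_sum, Finset.mul_sum]
  refine Finset.sum_congr rfl fun i _ => ?_
  have h3 : (algebraMap ℚ ℚ[X]) (1 / (i.factorial : ℚ)) = C ((i.factorial : ℚ)⁻¹) := by
    rw [one_div]
    rfl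
  have h4 : (n.factorial : ℚ[X]) = C (n.factorial : ℚ) := by simp
  have h5 : (2 : ℚ[X]) = C (2 : ℚ) := rfl
  rw [PowerSeries.coeff_rescale, PowerSeries.coeff_exp, PowerSeries.coeff_map, h3, h4, h5, C_mul,
    C_mul]
  change _ * (C 2 * (X ^ i * C _ * C (eulerCoeff (n - i)))) = _
  ring

theorem derivative_eulerPolynomial_succ (n : ℕ) :
    derivative (eulerPolynomial (n + 1)) = C ((n : ℚ) + 1) * eulerPolynomial n := by
  rw [eulerPolynomial_eq_sum, eulerPolynomial_eq_sum, derivative_C_mul, derivative_sum,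
    Finset.sum_range_succ', derivative_C_mul, pow_zero, derivative_one, mul_zero, add_zero,
    ← mul_assoc, ← C_mul, Finset.mul_sum, Finset.mul_sum]
  refine Finset.sum_congr rfl fun i _ => ?_
  rw [derivative_C_mul_X_pow, ← mul_assoc, ← mul_assoc, ← C_mul, ← C_mul, Nat.add_sub_cancel,
    Nat.add_sub_add_right]
  congr 2
  have h1 : ((i.factorial : ℕ) : ℚ) ≠ 0 := by exact_mod_cast i.factorial_ne_zero
  rw [Nat.factorial_succ, Nat.factorial_succ]
  push_cast
  field_simp

/-- Up to the factor 2 n!, this is the n-th coefficient of (e^x + 1) · (e^x + 1)⁻¹ = 1. -/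
theorem eval_eulerPolynomial_zero_add_one {n : ℕ} (hn : 0 < n) :
    (eulerPolynomial n).eval 0 + (eulerPolynomial n).eval 1 = 0 := by
  have h0 : PowerSeries.constantCoeff (PowerSeries.exp ℚ + 1) ≠ 0 := by simp
  have h := congrArg (PowerSeries.coeff n) (PowerSeries.mul_inv_cancel _ h0)
  rw [add_mul, one_mul, map_add, PowerSeries.coeff_mul,
    Finset.Nat.sum_antidiagonal_eq_sum_range_succ_mk, PowerSeries.coeff_one, if_neg hn.ne'] at h
  have h1 : (eulerPolynomial n).eval 1 = 2 * (n.factorial : ℚ) *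
      ∑ i ∈ Finset.range (n + 1), (i.factorial : ℚ)⁻¹ * eulerCoeff (n - i) := by
    rw [eulerPolynomial_eq_sum]
    simp [eval_finsetSum]
  have h2 : (eulerPolynomial n).eval 0 = 2 * (n.factorial : ℚ) * eulerCoeff n := by
    rw [eulerPolynomial_eq_sum, Finset.sum_range_succ']
    simp [eval_finsetSum]
  rw [h1, h2, ← mul_add, add_comm]
  have h3 : ∑ i ∈ Finset.range (n + 1), (i.factorial : ℚ)⁻¹ * eulerCoeff (n - i) + eulerCoeff n
      = 0 := by
    rw [← h]
    congr 1
    refine Finset.sum_congr rfl fun i _ => ?_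
    rw [PowerSeries.coeff_exp]
    simp [eulerCoeff]
  rw [h3, mul_zero]

theorem eulerPolynomial_zero : eulerPolynomial 0 = 1 := by
  have h : eulerCoeff 0 = 1 / 2 := by
    rw [eulerCoeff, PowerSeries.coeff_zero_eq_constantCoeff_apply, PowerSeries.constantCoeff_inv]
    simp
    norm_num
  rw [eulerPolynomial_eq_sum]
  simp only [Nat.factorial_zero, zero_add, Finset.sum_range_one, pow_zero, mul_one, h, ← C_mul]
  norm_num

theorem hasDerivAt_aeval_eulerPolynomial_succ (n : ℕ) (t : ℝ) :
    HasDerivAt (fun x : ℝ => aeval x (eulerPolynomial (n + 1)))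
      ((n + 1) * aeval t (eulerPolynomial n)) t := by
  have h := (eulerPolynomial (n + 1)).hasDerivAt_aeval t
  rw [derivative_eulerPolynomial_succ, map_mul, aeval_C] at h
  simpa using h

theorem aeval_eulerPolynomial_one_eq_neg {n : ℕ} (hn : 0 < n) :
    aeval (1 : ℝ) (eulerPolynomial n) = -aeval (0 : ℝ) (eulerPolynomial n) := by
  have h := congrArg (algebraMap ℚ ℝ) (eval_eulerPolynomial_zero_add_one hn)
  rw [map_add, map_zero, ← aeval_algebraMap_apply_eq_algebraMap_eval,
    ← aeval_algebraMap_apply_eq_algebraMap_eval, map_zero, map_one] at h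
  linarith

/-- A constant equal to its own negative is 0. The antisymmetry thus fixes the constant of
integration in the comparison of waves with Euler polynomials. -/
theorem eq_zero_of_hasDerivAt_zero_of_antisymm {f : ℝ → ℝ}
    (hf : ∀ t ∈ Set.Icc (0 : ℝ) 1, HasDerivAt f 0 t) (h01 : f 1 = -f 0) {t : ℝ}
    (ht : t ∈ Set.Icc (0 : ℝ) 1) : f t = 0 := by
  have hconst : ∀ t ∈ Set.Icc (0 : ℝ) 1, f t = f 0 :=
    constant_of_has_deriv_right_zero (fun x hx => (hf x hx).continuousAt.continuousWithinAt)
      fun x hx => (hf x ⟨hx.1, hx.2.le⟩).hasDerivWithinAt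
  have h1 := hconst 1 (by simp)
  have h2 := hconst t ht
  linarith

theorem aeval_eulerPolynomial_one {t : ℝ} (ht : t ∈ Set.Icc (0 : ℝ) 1) :
    aeval t (eulerPolynomial 1) = t - 1 / 2 := by
  have h := eq_zero_of_hasDerivAt_zero_of_antisymm
    (f := fun x => aeval x (eulerPolynomial 1) - (x - 1 / 2)) (fun x _ => by
      have h1 := hasDerivAt_aeval_eulerPolynomial_succ 0 x
      rw [eulerPolynomial_zero] at h1
      have h2 := h1.sub ((hasDerivAt_id x).sub_const (1 / 2))
      have h3 : (((0 : ℕ) : ℝ) + 1) * aeval x (1 : ℚ[X]) - 1 = 0 := by simp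
      rw [h3] at h2
      exact h2)
    (by
      rw [aeval_eulerPolynomial_one_eq_neg one_pos]
      ring) ht
  linarith

end EulerPolynomial

/-! ### The averaged waves are Euler polynomials -/

section LimitWaveEuler

open Polynomial

/-- Each differentiation moves the argument back by 1/2, whence the shift (m + 1)/2, and brings out
a factor -2, whence the constant. The two sides have equal derivatives by induction and are both
antisymmetric between 0 and 1. -/
theorem limitWave_add_half_eq (m : ℕ) {t : ℝ} (ht : t ∈ Set.Icc (0 : ℝ) 1) :
    limitWave m (t + ((m : ℝ) + 1) / 2) =
      (-1) ^ (m + 1) * 2 ^ m / ((m + 1).factorial : ℝ) * aeval t (eulerPolynomial (m + 1)) := by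
  induction m generalizing t with
  | zero =>
    rw [limitWave, aeval_eulerPolynomial_one ht,
      triangleWave_eq_one_sub (by simpa using ht.1) (by norm_num; linarith [ht.2])]
    norm_num
    ring
  | succ m ih =>
    refine sub_eq_zero.mp (eq_zero_of_hasDerivAt_zero_of_antisymm
      (f := fun t => limitWave (m + 1) (t + (((m + 1 : ℕ) : ℝ) + 1) / 2) -
        (-1) ^ (m + 1 + 1) * 2 ^ (m + 1) / ((m + 1 + 1).factorial : ℝ) *
          aeval t (eulerPolynomial (m + 1 + 1))) (fun x hx => ?_) ?_ ht)
    · have h1 := (hasDerivAt_limitWave_succ m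
        (x + (((m + 1 : ℕ) : ℝ) + 1) / 2)).comp_add_const x ((((m + 1 : ℕ) : ℝ) + 1) / 2)
      have h2 := (hasDerivAt_aeval_eulerPolynomial_succ (m + 1) x).const_mul
        ((-1) ^ (m + 1 + 1) * 2 ^ (m + 1) / ((m + 1 + 1).factorial : ℝ))
      have h3 := h1.sub h2
      have h4 : -2 * limitWave m (x + (((m + 1 : ℕ) : ℝ) + 1) / 2 - 1 / 2) -
          (-1) ^ (m + 1 + 1) * 2 ^ (m + 1) / ((m + 1 + 1).factorial : ℝ) *
            ((((m + 1 : ℕ) : ℝ) + 1) * aeval x (eulerPolynomial (m + 1))) = 0 := by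
        rw [show x + (((m + 1 : ℕ) : ℝ) + 1) / 2 - 1 / 2 = x + ((m : ℝ) + 1) / 2 by
          push_cast
          ring, ih hx, Nat.factorial_succ (m + 1)]
        have hf : ((m + 1).factorial : ℝ) ≠ 0 := by exact_mod_cast (m + 1).factorial_ne_zero
        push_cast
        field_simp
        ring
      rw [h4] at h3
      exact h3
    · rw [aeval_eulerPolynomial_one_eq_neg (by omega), zero_add,
        add_comm (1 : ℝ), antiperiodic_limitWave]
      ring

theorem limitWave_eq_of_even {m : ℕ} (hm : Even (m + 1)) {t : ℝ} (ht : t ∈ Set.Icc (0 : ℝ) 1) :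
    limitWave m t = (-1 : ℝ) ^ ((m + 1) / 2) * 2 ^ m / ((m + 1).factorial : ℝ) *
      aeval t (eulerPolynomial (m + 1)) := by
  have h := limitWave_add_half_eq m ht
  obtain ⟨j, hj⟩ := hm
  have hj' : ((m : ℝ) + 1) / 2 = j := by
    have : ((m : ℝ) + 1) = j + j := by exact_mod_cast hj
    rw [this]
    ring
  have hsq : ((-1 : ℝ) ^ j) * (-1) ^ j = 1 := by rw [← mul_pow]; simp
  have hpow : (-1 : ℝ) ^ (m + 1) = 1 := Even.neg_one_pow ⟨j, hj⟩
  rw [hj', limitWave_add_nat, hpow] at h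
  rw [show (m + 1) / 2 = j by omega, mul_div_assoc, mul_assoc, ← one_mul (2 ^ m : ℝ), ← h,
    ← mul_assoc, hsq, one_mul]

theorem limitWave_eq_of_odd_left {m : ℕ} (hm : Odd (m + 1)) {t : ℝ}
    (ht : t ∈ Set.Icc (0 : ℝ) (1 / 2)) :
    limitWave m t = (-1 : ℝ) ^ (m / 2) * 2 ^ m / ((m + 1).factorial : ℝ) *
      aeval (t + 1 / 2) (eulerPolynomial (m + 1)) := by
  have h := limitWave_add_half_eq m (t := t + 1 / 2) ⟨by linarith [ht.1], by linarith [ht.2]⟩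
  have hpow : (-1 : ℝ) ^ (m + 1) = -1 := hm.neg_one_pow
  obtain ⟨j, hj⟩ := hm
  -- For odd m + 1 the shift is a half-integer. Starting from t + 1/2 makes it an integer, which
  -- antiperiodicity turns into a sign; on the right half, t - 1/2 plays this role.
  have hj' : t + 1 / 2 + ((m : ℝ) + 1) / 2 = t + (j + 1 : ℕ) := by
    have : ((m : ℝ) + 1) = 2 * j + 1 := by exact_mod_cast hj
    rw [this]
    push_cast
    ring
  have hsq : ((-1 : ℝ) ^ j) * (-1) ^ j = 1 := by rw [← mul_pow]; simp
  rw [hj', limitWave_add_nat, hpow, pow_succ] at h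
  rw [show m / 2 = j by omega]
  linear_combination -(-1) ^ j * h - limitWave m t * hsq

theorem limitWave_eq_of_odd_right {m : ℕ} (hm : Odd (m + 1)) {t : ℝ}
    (ht : t ∈ Set.Icc (1 / 2 : ℝ) 1) :
    limitWave m t = -((-1 : ℝ) ^ (m / 2) * 2 ^ m / ((m + 1).factorial : ℝ) *
      aeval (t - 1 / 2) (eulerPolynomial (m + 1))) := by
  have h := limitWave_add_half_eq m (t := t - 1 / 2) ⟨by linarith [ht.1], by linarith [ht.2]⟩
  have hpow : (-1 : ℝ) ^ (m + 1) = -1 := hm.neg_one_pow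
  obtain ⟨j, hj⟩ := hm
  have hj' : t - 1 / 2 + ((m : ℝ) + 1) / 2 = t + j := by
    have : ((m : ℝ) + 1) = 2 * j + 1 := by exact_mod_cast hj
    rw [this]
    ring
  have hsq : ((-1 : ℝ) ^ j) * (-1) ^ j = 1 := by rw [← mul_pow]; simp
  rw [hj', limitWave_add_nat, hpow] at h
  rw [show m / 2 = j by omega]
  linear_combination (-1) ^ j * h - limitWave m t * hsq

end LimitWaveEuler

end

theorem theorem4p3 (n : ℕ) (hn : 2 ≤ n) :
    (∃ φ : ℝ → ℝ, IsLimitPhi (fermatQuadric n) φ) ∧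
    ∀ φ : ℝ → ℝ, IsLimitPhi (fermatQuadric n) φ →
      (Even n → ∀ t ∈ Set.Icc (0 : ℝ) 1,
        φ t = t + (-1 : ℝ) ^ (n / 2) * 2 ^ (n - 1) / (n.factorial : ℝ) *
          Polynomial.aeval t (eulerPolynomial n)) ∧
      (Odd n → ∀ t ∈ Set.Icc (0 : ℝ) (1 / 2),
        φ t = t + (-1 : ℝ) ^ ((n - 1) / 2) * 2 ^ (n - 1) / (n.factorial : ℝ) *
          Polynomial.aeval (t + 1 / 2) (eulerPolynomial n)) ∧
      (Odd n → ∀ t ∈ Set.Icc (1 / 2 : ℝ) 1,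
        φ t = t - (-1 : ℝ) ^ ((n - 1) / 2) * 2 ^ (n - 1) / (n.factorial : ℝ) *
          Polynomial.aeval (t - 1 / 2) (eulerPolynomial n)) := by
  obtain ⟨m, rfl⟩ := Nat.exists_eq_add_of_le' (show 1 ≤ n by omega)
  have hex : ∀ p : ℕ, ∃ Φ : ℝ → ℝ, p.Prime → IsPhi (fermatQuadric (m + 1) p) Φ := by
    intro p
    by_cases hp : p.Prime
    · have : Fact p.Prime := ⟨hp⟩
      obtain ⟨Φ, hlip, hval⟩ := exists_lipschitz_phi (m + 1) p (by omega)
      exact ⟨Φ, fun _ => ⟨hlip.continuous.continuousOn, fun e a _ => hval e a⟩⟩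
    -- Indices that are not prime are invisible to the filter, so any function will do.
    · exact ⟨0, fun h => absurd h hp⟩
  choose Φ hΦ using hex
  refine ⟨⟨_, Φ, hΦ, tendstoUniformlyOn_of_isPhi m hΦ⟩, ?_⟩
  rintro φ ⟨Ψ, hΨ, hlim⟩
  have hne : (atTop ⊓ 𝓟 {p : ℕ | p.Prime}).NeBot :=
    frequently_mem_iff_neBot.mp (Nat.frequently_atTop_iff_infinite.mpr Nat.infinite_setOfPred_prime)
  have hφ : ∀ t ∈ Set.Icc (0 : ℝ) 1, φ t = t + limitWave m t := fun t ht =>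
    tendsto_nhds_unique (hlim.tendsto_at ht) ((tendstoUniformlyOn_of_isPhi m hΨ).tendsto_at ht)
  rw [Nat.add_sub_cancel]
  refine ⟨fun he t ht => ?_, fun ho t ht => ?_, fun ho t ht => ?_⟩
  · rw [hφ t ht, limitWave_eq_of_even he ht]
  · rw [hφ t ⟨ht.1, ht.2.trans (by norm_num)⟩, limitWave_eq_of_odd_left ho ht]
  · rw [hφ t ⟨le_trans (by norm_num) ht.1, ht.2⟩, limitWave_eq_of_odd_right ho ht]
    exact (sub_eq_add_neg _ _).symm
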